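/- **Setting.** Let $\mathbb E_n$ be the space of positive definite symmetric real $n\times n$ matrices with the $\mathrm{GL}(n,\mathbb R)$-invariant Riemannian metric $ds^2=\operatorname{tr}(dX\,X^{-1}\,dX\,X^{-1})$, and let $\mathbb{PE}_n$ be the space of positive definite matrices up to a positive scalar factor, identified with $\{X\in\mathbb E_n:\det X=1\}$ with the induced metric. Write $\rho$ for the Riemannian distance of either space. A *geodesic* means a nonconstant complete directed geodesic $\nu$, considered up to orientation-preserving affine changes of parameter $t\mapsto at+b$, $a>0$. For a point $X$ and a geodesic $\nu$ put $\operatorname{dist}(X,\nu)=\inf_{s\in\mathbb R}\rho(X,\nu(s))$. Say that $\nu$ is *directed as* $\mu$ if for every $s_0\in\mathbb R$ one has $\operatorname{dist}(\mu(t),\nu)=\inf_{s\ge s_0}\rho(\mu(t),\nu(s))$ for all sufficiently large $t$. For a geodesic $\mu$: * the *finite pencil* $\Pi^{fin}_\mu$ is the set of all geodesics $\nu$ directed as $\mu$ for which the finite limit $\lim_{t\to+\infty}\operatorname{dist}(\mu(t),\nu)$ exists; * the *null pencil* $\Pi^{nul}_\mu$ is the set of all geodesics $\nu$ directed as $\mu$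 for which $\lim_{t\to+\infty}\operatorname{dist}(\mu(t),\nu)=0$. **Theorem 3.3.** Let $\alpha_1,\dots,\alpha_m$ be positive integers with sum $n$, let $\psi_1>\psi_2>\dots>\psi_m$ be real numbers, let $E_\alpha$ be the $\alpha\times\alpha$ unit matrix, and let $$\gamma(t)=\operatorname{diag}\bigl(e^{\psi_1t}E_{\alpha_1},\,e^{\psi_2t}E_{\alpha_2},\,\dots,\,e^{\psi_mt}E_{\alpha_m}\bigr),$$ considered either in $\mathbb E_n$ or (up to scalar factors) in $\mathbb{PE}_n$, where it is assumed to be nonconstant in the space in question (in $\mathbb E_n$: some $\psi_k\neq0$; in $\mathbb{PE}_n$: $m>1$). Then in each of the two spaces: a) The finite pencil $\Pi^{fin}_\gamma$ consists of exactly the geodesics that can be represented in the form $h\gamma(t)h^\top$ (up to scalar factors in the case of $\mathbb{PE}_n$), where $h$ ranges over the invertible $(\alpha_1+\alpha_2+\cdots)\times(\alpha_1+\alpha_2+\cdots)$ block triangular matrices $$h=\begin{pmatrix}H_{11}&H_{12}&H_{13}&\dots\\0&H_{22}&H_{23}&\dots\\0&0&H_{33}&\dots\\\vdots&\vdots&\vdots&\ddots\end{pmatrix}.$$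 b) The null pencil $\Pi^{nul}_\gamma$ consists of exactly the geodesics that can be represented in this form with all diagonal blocks equal to unit matrices, $H_{kk}=E_{\alpha_k}$. -/

import Mathlib

open Filter Topology
open scoped Matrix ContDiff

noncomputable section

namespace SymPencil

/-! Matrices are real and indexed by an arbitrary finite type `ι`, so that "size `n`" is the
cardinality of `ι`.  Derivatives of matrix-valued functions are taken entry by entry. -/

variable {ι : Type*} [Fintype ι] [DecidableEq ι]

/-- The space `𝔼` of positive definite symmetric real matrices. -/
def EE (ι : Type*) [Fintype ι] [DecidableEq ι] : Set (Matrix ι ι ℝ) :=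
  {X | X.PosDef}

/-- The space `ℙ𝔼` of positive definite matrices up to a positive factor; each class is
represented by its unique element of determinant `1`. -/
def PEE (ι : Type*) [Fintype ι] [DecidableEq ι] : Set (Matrix ι ι ℝ) :=
  {X | X.PosDef ∧ X.det = 1}

/-- The projection `𝔼 → ℙ𝔼`: the representative of determinant `1` of the class of `X`. -/
def toPEE (X : Matrix ι ι ℝ) : Matrix ι ι ℝ :=
  (X.det ^ (-(1 / (Fintype.card ι : ℝ)))) • X

/-- The entrywise derivative of a curve of matrices. -/
def velocity (c : ℝ → Matrix ι ι ℝ) (t : ℝ) : Matrix ι ι ℝ :=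
  Matrix.of fun i j => deriv (fun s => c s i j) t

/-- The Riemannian metric `ds² = tr (dX · X⁻¹ · dX · X⁻¹)` on `𝔼`, polarized. On `ℙ𝔼`, the induced
metric is used. -/
def metric (X V W : Matrix ι ι ℝ) : ℝ :=
  (V * X⁻¹ * W * X⁻¹).trace

/-- The length of the curve `c` on `[0, 1]`. -/
def length (c : ℝ → Matrix ι ι ℝ) : ℝ :=
  ∫ t in (0 : ℝ)..1, √(metric (c t) (velocity c t) (velocity c t))

/-- The Riemannian distance `ρ(X, Y)` in the submanifold `S` of `𝔼`: the infimum of the lengths of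
the `C¹` curves in `S` that go from `X` to `Y`. -/
def rho (S : Set (Matrix ι ι ℝ)) (X Y : Matrix ι ι ℝ) : ℝ :=
  sInf {l | ∃ c : ℝ → Matrix ι ι ℝ, (∀ i j, ContDiff ℝ 1 fun t => c t i j) ∧
    (∀ t ∈ Set.Icc (0 : ℝ) 1, c t ∈ S) ∧ c 0 = X ∧ c 1 = Y ∧ l = length c}

/-- The tangent vectors at `X` to the submanifold `S`: the velocities at `X` of curves in `S`. -/
def tangentTo (S : Set (Matrix ι ι ℝ)) (X : Matrix ι ι ℝ) : Set (Matrix ι ι ℝ) :=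
  {W | ∃ c : ℝ → Matrix ι ι ℝ, c 0 = X ∧ (∀ᶠ s in 𝓝 (0 : ℝ), c s ∈ S) ∧
    ∀ i j, HasDerivAt (fun s => c s i j) (W i j) 0}

/-- (Nonconstant, complete, parametrized) geodesics of the submanifold `S` of `𝔼` with the induced
metric `g`. The last field is the geodesic equation, i.e. the Euler–Lagrange equation of the energy
`½ ∫ g(μ', μ')`, tested against the tangent vectors `W` of `S`:
`d/dt g(μ', W) = ½ (D_W g)(μ', μ')`, where `W` is constant along `μ` on the left; in terms of the
Levi-Civita connection of `𝔼` it says that `∇_{μ'} μ'` is orthogonal to `S`. The direction of the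
geodesic is that of increasing parameter. -/
structure IsGeodesic (S : Set (Matrix ι ι ℝ)) (μ : ℝ → Matrix ι ι ℝ) : Prop where
  smooth : ∀ i j, ContDiff ℝ ∞ fun t => μ t i j
  mem : ∀ t, μ t ∈ S
  nonconstant : ∃ s t, μ s ≠ μ t
  equation : ∀ t, ∀ W ∈ tangentTo S (μ t),
    deriv (fun s => metric (μ s) (velocity μ s) W) t =
      1 / 2 * deriv (fun ε : ℝ => metric (μ t + ε • W) (velocity μ t) (velocity μ t)) 0

/-- Two parametrized geodesics are the same directed geodesic: one is obtained from the other by an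
orientation-preserving affine change of the parameter. -/
def SameDirected (ν μ : ℝ → Matrix ι ι ℝ) : Prop :=
  ∃ a b : ℝ, 0 < a ∧ ∀ t, ν t = μ (a * t + b)

/-- The distance `dist(X, ν)` from a point to a geodesic. -/
def distTo (S : Set (Matrix ι ι ℝ)) (X : Matrix ι ι ℝ) (ν : ℝ → Matrix ι ι ℝ) : ℝ :=
  ⨅ s : ℝ, rho S X (ν s)

/-- The direction of `ν` agrees with that of `μ`: as `μ(t)` runs to the positive end of `μ`, its
distance to `ν` is realized arbitrarily far in the positive direction of `ν`. (A geodesic run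
backwards is another directed geodesic, although it has the same points.) -/
def CoDirected (S : Set (Matrix ι ι ℝ)) (μ ν : ℝ → Matrix ι ι ℝ) : Prop :=
  ∀ s₀ : ℝ, ∀ᶠ t in atTop, distTo S (μ t) ν = ⨅ s : Set.Ici s₀, rho S (μ t) (ν s)

/-- The finite pencil of `μ`: all the directed geodesics `ν`, directed as `μ`, for which
`dist(μ(t), ν)` has a finite limit as `t → +∞`. -/
def finitePencil (S : Set (Matrix ι ι ℝ)) (μ : ℝ → Matrix ι ι ℝ) : Set (ℝ → Matrix ι ι ℝ) :=
  {ν | IsGeodesic S ν ∧ CoDirected S μ ν ∧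
    ∃ L : ℝ, Tendsto (fun t => distTo S (μ t) ν) atTop (𝓝 L)}

/-- The null pencil of `μ`: all the directed geodesics `ν`, directed as `μ`, for which
`dist(μ(t), ν) → 0` as `t → +∞`. -/
def nullPencil (S : Set (Matrix ι ι ℝ)) (μ : ℝ → Matrix ι ι ℝ) : Set (ℝ → Matrix ι ι ℝ) :=
  {ν | IsGeodesic S ν ∧ CoDirected S μ ν ∧
    Tendsto (fun t => distTo S (μ t) ν) atTop (𝓝 0)}

/-- The index set of the rows of an `(α₁ + ⋯ + αₘ) × (α₁ + ⋯ + αₘ)` block matrix: the pairs of a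
block number and a position in the block. -/
abbrev Idx {m : ℕ} (α : Fin m → ℕ) : Type := (k : Fin m) × Fin (α k)

/-- `γ(t)`, the block diagonal matrix with the blocks `exp (ψₖ t) E` of sizes `αₖ`. -/
def gam {m : ℕ} (α : Fin m → ℕ) (ψ : Fin m → ℝ) (t : ℝ) : Matrix (Idx α) (Idx α) ℝ :=
  Matrix.diagonal fun i => Real.exp (ψ i.1 * t)

/-- The group of the invertible block upper triangular matrices: the blocks `H k l` with `l < k`
vanish (`k` is the block row, `l` the block column). -/
def blockTri {m : ℕ} (α : Fin m → ℕ) : Set (Matrix (Idx α) (Idx α) ℝ) :=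
  {h | IsUnit h.det ∧ ∀ i j : Idx α, j.1 < i.1 → h i j = 0}

/-- The group of the block unipotent upper triangular matrices: moreover, the diagonal blocks are
unit matrices. -/
def blockUni {m : ℕ} (α : Fin m → ℕ) : Set (Matrix (Idx α) (Idx α) ℝ) :=
  {h | (∀ i j : Idx α, j.1 < i.1 → h i j = 0) ∧ ∀ k, h.blockDiag' k = 1}

end SymPencil

end

open SymPencil

/-! Congruences `X ↦ h X hᵀ` act by isometries (`rho_congr`), and the geodesics are exactly the
curves `k exp(t diag l) kᵀ` (`isGeodesic_iff`). The argument is uniform in `slice p`, where `p`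
imposes determinant 1, that is, exponents of sum zero.

Triangular `h` give members of the pencil. Conjugating `h` by `exp(-(t/2) diag l)` damps the entries
off the diagonal blocks, so the conjugates tend to the block diagonal part `D` (`tendsto_conjDiag`),
and `h γ hᵀ` is asymptotic to `D γ Dᵀ`. As `D` commutes with `γ`, translation along `γ` is an
isometry shifting both `γ` and `D γ Dᵀ`; the distance between these two is therefore constant. The
limit of `dist(γ(t), h γ hᵀ)` is thus the infimum over `s` of `ρ(1, D γ(s) Dᵀ)`
(`tendsto_distTo_expCurve`).

Conversely, `log (vᵀ X v)` is 1-Lipschitz in `X` (`abs_log_sub_log_le_rho`). Testing a geodesic `k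
exp(t diag m) kᵀ` of the finite pencil on basis vectors matches its parameter affinely with that of
`γ` (`exists_affine_of_bounded`). After this reparametrization, `k i j ≠ 0` forces `m j ≤ l i`
(`le_of_rho_bounded`). The same holds for `k⁻¹` with `l` and `m` exchanged, so `m` is a permutation
of `l`, and permuting the columns of `k` makes it triangular (`exists_isTri_of_rho_bounded`).

In the null pencil the infimum is zero and is attained (`exists_expCurve_eq_one`). Hence `D γ Dᵀ` is
`γ` with its parameter shifted, and `h` may be replaced by the unipotent `h D⁻¹`. -/

set_option linter.unusedSectionVars false

namespace SymPencil

/-! ### Congruences, simultaneous diagonalization and the invariant metric. -/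

section

variable {ι : Type*} [Fintype ι] [DecidableEq ι]

/-- The positive definite matrices, normalized to determinant `1` if `p` holds. This treats `𝔼`
(`p = False`) and `ℙ𝔼` (`p = True`) simultaneously. -/
def slice (p : Prop) (ι : Type*) [Fintype ι] [DecidableEq ι] : Set (Matrix ι ι ℝ) :=
  {X | X.PosDef ∧ (p → X.det = 1)}

theorem EE_eq_slice : EE ι = slice False ι := by simp [EE, slice]

theorem PEE_eq_slice : PEE ι = slice True ι := by simp [PEE, slice]

/-- The matrices acting on `slice p ι` by congruence. -/
structure Preserves (p : Prop) (h : Matrix ι ι ℝ) : Prop where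
  det_ne : h.det ≠ 0
  det_sq : p → h.det ^ 2 = 1

theorem Preserves.inv {p : Prop} {h : Matrix ι ι ℝ} (hh : Preserves p h) : Preserves p h⁻¹ := by
  constructor
  · rw [Matrix.det_nonsing_inv, Ring.inverse_eq_inv']
    exact inv_ne_zero hh.det_ne
  · intro hp
    rw [Matrix.det_nonsing_inv, Ring.inverse_eq_inv', inv_pow, hh.det_sq hp, inv_one]

theorem Preserves.isUnit {p : Prop} {h : Matrix ι ι ℝ} (hh : Preserves p h) : IsUnit h.det :=
  hh.det_ne.isUnit

theorem inv_transpose_mul_transpose {h : Matrix ι ι ℝ} (hh : IsUnit h.det) : h⁻¹ᵀ * hᵀ = 1 := by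
  rw [← Matrix.transpose_mul, Matrix.mul_nonsing_inv _ hh, Matrix.transpose_one]

theorem transpose_mul_inv_transpose {h : Matrix ι ι ℝ} (hh : IsUnit h.det) : hᵀ * h⁻¹ᵀ = 1 := by
  rw [← Matrix.transpose_mul, Matrix.nonsing_inv_mul _ hh, Matrix.transpose_one]

theorem congr_inv_congr {h : Matrix ι ι ℝ} (hh : IsUnit h.det) (X : Matrix ι ι ℝ) :
    h⁻¹ * (h * X * hᵀ) * h⁻¹ᵀ = X := by
  calc h⁻¹ * (h * X * hᵀ) * h⁻¹ᵀ = (h⁻¹ * h) * X * (hᵀ * h⁻¹ᵀ) := by simp only [Matrix.mul_assoc]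
    _ = X := by rw [Matrix.nonsing_inv_mul _ hh, transpose_mul_inv_transpose hh]; simp

theorem congr_congr_inv {h : Matrix ι ι ℝ} (hh : IsUnit h.det) (X : Matrix ι ι ℝ) :
    h * (h⁻¹ * X * h⁻¹ᵀ) * hᵀ = X := by
  calc h * (h⁻¹ * X * h⁻¹ᵀ) * hᵀ = (h * h⁻¹) * X * (h⁻¹ᵀ * hᵀ) := by simp only [Matrix.mul_assoc]
    _ = X := by rw [Matrix.mul_nonsing_inv _ hh, inv_transpose_mul_transpose hh]; simp

theorem posDef_congr {h X : Matrix ι ι ℝ} (hh : IsUnit h.det) (hX : X.PosDef) :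
    (h * X * hᵀ).PosDef := by
  have := hX.mul_mul_conjTranspose_same (B := h)
    (Matrix.vecMul_injective_of_isUnit ((Matrix.isUnit_iff_isUnit_det _).2 hh))
  simpa [Matrix.conjTranspose_eq_transpose_of_trivial] using this

theorem slice_congr {p : Prop} {h X : Matrix ι ι ℝ} (hh : Preserves p h) (hX : X ∈ slice p ι) :
    h * X * hᵀ ∈ slice p ι := by
  refine ⟨posDef_congr hh.isUnit hX.1, fun hp => ?_⟩
  rw [Matrix.det_mul, Matrix.det_mul, Matrix.det_transpose, hX.2 hp, mul_one, ← sq, hh.det_sq hp]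

theorem isUnit_det {p : Prop} {X : Matrix ι ι ℝ} (hX : X ∈ slice p ι) : IsUnit X.det :=
  hX.1.det_pos.ne'.isUnit

theorem transpose_eq_of_mem {p : Prop} {X : Matrix ι ι ℝ} (hX : X ∈ slice p ι) : Xᵀ = X := by
  have := hX.1.1.eq
  rwa [Matrix.conjTranspose_eq_transpose_of_trivial] at this

theorem diagonal_congr_apply (k : Matrix ι ι ℝ) (d : ι → ℝ) (i j : ι) :
    (k * Matrix.diagonal d * kᵀ) i j = ∑ x, k i x * d x * k j x := by
  simp [Matrix.mul_apply, Matrix.diagonal_apply]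

theorem exists_orthogonal_diag {B : Matrix ι ι ℝ} (hB : Bᵀ = B) :
    ∃ (O : Matrix ι ι ℝ) (l : ι → ℝ), O * Oᵀ = 1 ∧ B = O * Matrix.diagonal l * Oᵀ := by
  have hH : B.IsHermitian := by
    rwa [Matrix.IsHermitian, Matrix.conjTranspose_eq_transpose_of_trivial]
  refine ⟨hH.eigenvectorUnitary, hH.eigenvalues, ?_, ?_⟩
  · have := Unitary.mul_star_self_of_mem hH.eigenvectorUnitary.2
    rwa [Matrix.star_eq_conjTranspose, Matrix.conjTranspose_eq_transpose_of_trivial] at this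
  · have := hH.spectral_theorem
    rw [Unitary.conjStarAlgAut_apply, Matrix.star_eq_conjTranspose,
      Matrix.conjTranspose_eq_transpose_of_trivial] at this
    exact this

theorem isUnit_det_of_mul_transpose {k X : Matrix ι ι ℝ} (hX : X.PosDef) (h : X = k * kᵀ) :
    IsUnit k.det := by
  have := hX.det_pos
  rw [h, Matrix.det_mul, Matrix.det_transpose] at this
  exact (left_ne_zero_of_mul this.ne').isUnit

theorem preserves_of_mul_transpose {p : Prop} {k X : Matrix ι ι ℝ} (hX : X ∈ slice p ι)
    (h : X = k * kᵀ) : Preserves p k := by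
  refine ⟨(isUnit_det_of_mul_transpose hX.1 h).ne_zero, fun hp => ?_⟩
  have := hX.2 hp
  rwa [h, Matrix.det_mul, Matrix.det_transpose, ← sq] at this

theorem exists_mul_transpose {X : Matrix ι ι ℝ} (hX : X.PosDef) :
    ∃ g : Matrix ι ι ℝ, X = g * gᵀ := by
  have hT : Xᵀ = X := by
    have := hX.1.eq
    rwa [Matrix.conjTranspose_eq_transpose_of_trivial] at this
  obtain ⟨O, l, hO, hl⟩ := exists_orthogonal_diag hT
  have hO' : Oᵀ * O = 1 := mul_eq_one_comm.1 hO
  have hOu : IsUnit Oᵀ.det := Matrix.isUnit_det_of_right_inverse hO'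
  have hD : Matrix.diagonal l = Oᵀ * X * Oᵀᵀ := by
    rw [hl, Matrix.transpose_transpose]
    calc Matrix.diagonal l = (Oᵀ * O) * Matrix.diagonal l * (Oᵀ * O) := by rw [hO']; simp
      _ = _ := by simp only [Matrix.mul_assoc]
  have hpos : ∀ i, 0 < l i := by
    have := posDef_congr hOu hX
    rw [← hD] at this
    exact Matrix.posDef_diagonal_iff.1 this
  refine ⟨O * Matrix.diagonal fun i => √(l i), ?_⟩
  rw [Matrix.transpose_mul, Matrix.diagonal_transpose, hl]
  calc O * Matrix.diagonal l * Oᵀ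
      = O * (Matrix.diagonal (fun i => √(l i)) * Matrix.diagonal fun i => √(l i)) * Oᵀ := by
        rw [Matrix.diagonal_mul_diagonal]
        simp [Real.mul_self_sqrt (hpos _).le]
    _ = _ := by simp only [Matrix.mul_assoc]

/-- Simultaneous diagonalization of a positive definite and a symmetric form. -/
theorem exists_simultaneous_diag {X W : Matrix ι ι ℝ} (hX : X.PosDef) (hW : Wᵀ = W) :
    ∃ (k : Matrix ι ι ℝ) (l : ι → ℝ), X = k * kᵀ ∧ W = k * Matrix.diagonal l * kᵀ := by
  obtain ⟨g, hg⟩ := exists_mul_transpose hX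
  have hu := isUnit_det_of_mul_transpose hX hg
  have hB : (g⁻¹ * W * g⁻¹ᵀ)ᵀ = g⁻¹ * W * g⁻¹ᵀ := by
    simp [Matrix.transpose_mul, hW, Matrix.mul_assoc]
  obtain ⟨O, l, hO, hl⟩ := exists_orthogonal_diag hB
  refine ⟨g * O, l, ?_, ?_⟩
  · rw [Matrix.transpose_mul, hg]
    calc g * gᵀ = g * (O * Oᵀ) * gᵀ := by rw [hO, Matrix.mul_one]
      _ = _ := by simp only [Matrix.mul_assoc]
  · rw [← congr_congr_inv hu W, hl, Matrix.transpose_mul]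
    simp only [Matrix.mul_assoc]

theorem mul_transpose_inv {k : Matrix ι ι ℝ} : (k * kᵀ)⁻¹ = k⁻¹ᵀ * k⁻¹ := by
  rw [Matrix.mul_inv_rev, Matrix.transpose_nonsing_inv]

theorem congr_inv {h : Matrix ι ι ℝ} (X : Matrix ι ι ℝ) :
    (h * X * hᵀ)⁻¹ = h⁻¹ᵀ * X⁻¹ * h⁻¹ := by
  rw [Matrix.mul_inv_rev, Matrix.mul_inv_rev, Matrix.transpose_nonsing_inv, Matrix.mul_assoc]

theorem congr_mul_inv_congr {h : Matrix ι ι ℝ} (hh : IsUnit h.det) (X V : Matrix ι ι ℝ) :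
    (h * V * hᵀ) * (h * X * hᵀ)⁻¹ = h * (V * X⁻¹) * h⁻¹ := by
  rw [congr_inv]
  calc (h * V * hᵀ) * (h⁻¹ᵀ * X⁻¹ * h⁻¹) = h * V * (hᵀ * h⁻¹ᵀ) * X⁻¹ * h⁻¹ := by
        simp only [Matrix.mul_assoc]
    _ = _ := by rw [transpose_mul_inv_transpose hh]; simp only [Matrix.mul_one, Matrix.mul_assoc]

theorem metric_congr {h : Matrix ι ι ℝ} (hh : IsUnit h.det) (X V W : Matrix ι ι ℝ) :
    metric (h * X * hᵀ) (h * V * hᵀ) (h * W * hᵀ) = metric X V W := by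
  unfold metric
  rw [Matrix.mul_assoc (h * V * hᵀ * _), congr_mul_inv_congr hh, congr_mul_inv_congr hh]
  calc (h * (V * X⁻¹) * h⁻¹ * (h * (W * X⁻¹) * h⁻¹)).trace
      = (h * ((V * X⁻¹) * ((h⁻¹ * h) * (W * X⁻¹))) * h⁻¹).trace := by simp only [Matrix.mul_assoc]
    _ = _ := by
        rw [Matrix.trace_mul_comm, ← Matrix.mul_assoc, Matrix.nonsing_inv_mul _ hh]
        simp only [Matrix.one_mul, Matrix.mul_assoc]

theorem metric_smul (X V : Matrix ι ι ℝ) (a : ℝ) :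
    metric X (a • V) (a • V) = a ^ 2 * metric X V V := by
  simp [metric, Matrix.trace_smul]; ring

theorem metric_one (V W : Matrix ι ι ℝ) : metric 1 V W = (V * W).trace := by simp [metric]

theorem trace_mul_self_of_symm {B : Matrix ι ι ℝ} (hB : Bᵀ = B) :
    (B * B).trace = ∑ i, ∑ j, B i j ^ 2 := by
  simp only [Matrix.trace, Matrix.diag_apply, Matrix.mul_apply]
  refine Finset.sum_congr rfl fun i _ => Finset.sum_congr rfl fun j _ => ?_
  rw [sq]
  congr 1
  exact congrFun (congrFun hB i) j

theorem dotProduct_congr (g B : Matrix ι ι ℝ) (v : ι → ℝ) :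
    v ⬝ᵥ (g * B * gᵀ) *ᵥ v = (gᵀ *ᵥ v) ⬝ᵥ B *ᵥ (gᵀ *ᵥ v) := by
  rw [← Matrix.mulVec_mulVec, ← Matrix.mulVec_mulVec, Matrix.dotProduct_mulVec,
    Matrix.mulVec_transpose g v]

/-- The quadratic form of a tangent vector is bounded by its norm. -/
theorem sq_dotProduct_le_metric {X V : Matrix ι ι ℝ} (hX : X.PosDef) (hV : Vᵀ = V) (v : ι → ℝ) :
    (v ⬝ᵥ V *ᵥ v) ^ 2 ≤ (v ⬝ᵥ X *ᵥ v) ^ 2 * metric X V V := by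
  obtain ⟨k, l, hk, hl⟩ := exists_simultaneous_diag hX hV
  have hu := isUnit_det_of_mul_transpose hX hk
  have hX1 : X = k * 1 * kᵀ := by rw [Matrix.mul_one, hk]
  rw [hX1, hl, metric_congr hu, metric_one, dotProduct_congr, dotProduct_congr,
    Matrix.diagonal_mul_diagonal, Matrix.trace_diagonal]
  set w := kᵀ *ᵥ v
  simp only [Matrix.one_mulVec, dotProduct, Matrix.mulVec_diagonal]
  -- In the diagonalizing basis the claim is Cauchy–Schwarz, followed by `∑ aᵢ² ≤ (∑ aᵢ)²` for `aᵢ ≥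
  -- 0`.
  have h1 : (∑ i, w i * (l i * w i)) ^ 2 ≤ (∑ i, (w i * w i) ^ 2) * ∑ i, l i ^ 2 := by
    have := Finset.sum_mul_sq_le_sq_mul_sq Finset.univ (fun i => w i * w i) l
    refine le_trans (le_of_eq ?_) this
    congr 1
    exact Finset.sum_congr rfl fun i _ => by ring
  have h2 : ∑ i, (w i * w i) ^ 2 ≤ (∑ i, w i * w i) ^ 2 :=
    Finset.sum_sq_le_sq_sum_of_nonneg fun i _ => mul_self_nonneg _
  calc _ ≤ _ := h1
    _ ≤ (∑ i, w i * w i) ^ 2 * ∑ i, l i ^ 2 := by gcongr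
    _ = _ := by simp only [sq]

theorem metric_self_nonneg {X V : Matrix ι ι ℝ} (hX : X.PosDef) (hV : Vᵀ = V) :
    0 ≤ metric X V V := by
  obtain ⟨k, l, hk, hl⟩ := exists_simultaneous_diag hX hV
  have hu := isUnit_det_of_mul_transpose hX hk
  have hX1 : X = k * 1 * kᵀ := by rw [Matrix.mul_one, hk]
  rw [hX1, hl, metric_congr hu, metric_one, Matrix.diagonal_mul_diagonal, Matrix.trace_diagonal]
  exact Finset.sum_nonneg fun i _ => mul_self_nonneg _

theorem eq_zero_of_metric_self {X V : Matrix ι ι ℝ} (hX : X.PosDef) (hV : Vᵀ = V)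
    (h : metric X V V = 0) : V = 0 := by
  obtain ⟨k, l, hk, hl⟩ := exists_simultaneous_diag hX hV
  have hu := isUnit_det_of_mul_transpose hX hk
  have hX1 : X = k * 1 * kᵀ := by rw [Matrix.mul_one, hk]
  rw [hX1, hl, metric_congr hu, metric_one, Matrix.diagonal_mul_diagonal, Matrix.trace_diagonal,
    Finset.sum_eq_zero_iff_of_nonneg fun i _ => mul_self_nonneg _] at h
  have h0 : l = 0 := funext fun i => mul_self_eq_zero.1 (h i (Finset.mem_univ _))
  rw [hl, h0]
  simp

/-- Translates the tangency condition `tr (X⁻¹ W) = 0` for determinant 1 into exponents of sum zero.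
-/
theorem trace_inv_mul_diag {k : Matrix ι ι ℝ} (hk : IsUnit k.det) (l : ι → ℝ) :
    ((k * kᵀ)⁻¹ * (k * Matrix.diagonal l * kᵀ)).trace = ∑ i, l i := by
  have := congr_mul_inv_congr hk 1 (Matrix.diagonal l)
  rw [Matrix.mul_one] at this
  rw [Matrix.trace_mul_comm, this, Matrix.trace_mul_comm, ← Matrix.mul_assoc,
    Matrix.nonsing_inv_mul _ hk]
  simp

end

/-! ### Entrywise calculus of matrix curves and the exponential curves. -/

section

variable {ι : Type*} [Fintype ι] [DecidableEq ι]

/-- `c` has the entrywise derivative `V` at `t`. -/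
def HasMatDeriv (c : ℝ → Matrix ι ι ℝ) (V : Matrix ι ι ℝ) (t : ℝ) : Prop :=
  ∀ i j, HasDerivAt (fun s => c s i j) (V i j) t

theorem HasMatDeriv.velocity_eq {c : ℝ → Matrix ι ι ℝ} {V : Matrix ι ι ℝ} {t : ℝ}
    (h : HasMatDeriv c V t) : velocity c t = V := by
  ext i j
  exact (h i j).deriv

theorem hasMatDeriv_const (A : Matrix ι ι ℝ) (t : ℝ) : HasMatDeriv (fun _ => A) 0 t :=
  fun i j => hasDerivAt_const t (A i j)

theorem HasMatDeriv.mul {c d : ℝ → Matrix ι ι ℝ} {V W : Matrix ι ι ℝ} {t : ℝ}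
    (hc : HasMatDeriv c V t) (hd : HasMatDeriv d W t) :
    HasMatDeriv (fun s => c s * d s) (V * d t + c t * W) t := by
  intro i j
  simp only [Matrix.mul_apply, Matrix.add_apply, ← Finset.sum_add_distrib]
  exact HasDerivAt.fun_sum fun x _ => (hc i x).mul (hd x j)

theorem HasMatDeriv.const_mul {c : ℝ → Matrix ι ι ℝ} {V : Matrix ι ι ℝ} {t : ℝ}
    (A : Matrix ι ι ℝ) (hc : HasMatDeriv c V t) : HasMatDeriv (fun s => A * c s) (A * V) t := by
  simpa using (hasMatDeriv_const A t).mul hc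

theorem HasMatDeriv.mul_const {c : ℝ → Matrix ι ι ℝ} {V : Matrix ι ι ℝ} {t : ℝ}
    (hc : HasMatDeriv c V t) (A : Matrix ι ι ℝ) : HasMatDeriv (fun s => c s * A) (V * A) t := by
  simpa using hc.mul (hasMatDeriv_const A t)

theorem HasMatDeriv.trace {c : ℝ → Matrix ι ι ℝ} {V : Matrix ι ι ℝ} {t : ℝ}
    (hc : HasMatDeriv c V t) : HasDerivAt (fun s => (c s).trace) V.trace t :=
  HasDerivAt.fun_sum fun i _ => hc i i

theorem HasMatDeriv.dotProduct {c : ℝ → Matrix ι ι ℝ} {V : Matrix ι ι ℝ} {t : ℝ}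
    (hc : HasMatDeriv c V t) (v : ι → ℝ) :
    HasDerivAt (fun s => v ⬝ᵥ c s *ᵥ v) (v ⬝ᵥ V *ᵥ v) t := by
  change HasDerivAt (fun s => ∑ i, v i * ∑ j, c s i j * v j) (∑ i, v i * ∑ j, V i j * v j) t
  exact HasDerivAt.fun_sum fun i _ =>
    (HasDerivAt.fun_sum fun j _ => (hc i j).mul_const (v j)).const_mul (v i)

theorem HasMatDeriv.scomp {c : ℝ → Matrix ι ι ℝ} {V : Matrix ι ι ℝ} {f : ℝ → ℝ} {a t : ℝ}
    (hc : HasMatDeriv c V (f t)) (hf : HasDerivAt f a t) :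
    HasMatDeriv (fun s => c (f s)) (a • V) t := by
  intro i j
  have := (hc i j).comp t hf
  rwa [mul_comm] at this

section

attribute [local instance] Matrix.linftyOpNormedRing Matrix.linftyOpNormedAlgebra

/-- Entrywise differentiation agrees with differentiation in a normed ring, where the derivative of
the inverse is available. -/
theorem hasMatDeriv_iff {c : ℝ → Matrix ι ι ℝ} {V : Matrix ι ι ℝ} {t : ℝ} :
    HasMatDeriv c V t ↔ HasDerivAt c V t := by
  refine Iff.trans ?_ hasDerivAt_pi.symm
  exact forall_congr' fun i => hasDerivAt_pi.symm

theorem HasMatDeriv.inv {c : ℝ → Matrix ι ι ℝ} {V : Matrix ι ι ℝ} {t : ℝ}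
    (hc : HasMatDeriv c V t) (h : IsUnit (c t).det) :
    HasMatDeriv (fun s => (c s)⁻¹) (-((c t)⁻¹ * V * (c t)⁻¹)) t := by
  rw [hasMatDeriv_iff] at hc ⊢
  obtain ⟨u, hu⟩ := (Matrix.isUnit_iff_isUnit_det _).2 h
  have : CompleteSpace (Matrix ι ι ℝ) := FiniteDimensional.complete ℝ _
  have h1 := hasFDerivAt_ringInverse (𝕜 := ℝ) u
  rw [hu] at h1
  have h2 : HasDerivAt (fun s => Ring.inverse (c s)) _ t := h1.comp_hasDerivAt t hc
  convert h2 using 1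
  · exact funext fun s => Matrix.nonsing_inv_eq_ringInverse _
  · simp [← hu, Matrix.coe_units_inv]

end

theorem hasMatDeriv_velocity {c : ℝ → Matrix ι ι ℝ} {n : WithTop ℕ∞}
    (hc : ∀ i j, ContDiff ℝ n fun t => c t i j) (hn : n ≠ 0) (t : ℝ) :
    HasMatDeriv c (velocity c t) t :=
  fun i j => ((hc i j).differentiable hn t).hasDerivAt

/-- The curve `k exp(t diag l) kᵀ`. -/
noncomputable def expCurve (k : Matrix ι ι ℝ) (l : ι → ℝ) (t : ℝ) : Matrix ι ι ℝ :=
  k * Matrix.diagonal (fun i => Real.exp (l i * t)) * kᵀ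

theorem expCurve_contDiff (k : Matrix ι ι ℝ) (l : ι → ℝ) (n : WithTop ℕ∞) (i j : ι) :
    ContDiff ℝ n fun t => expCurve k l t i j := by
  simp only [expCurve, diagonal_congr_apply]
  fun_prop

theorem expCurve_hasMatDeriv (k : Matrix ι ι ℝ) (l : ι → ℝ) (t : ℝ) :
    HasMatDeriv (expCurve k l)
      (k * Matrix.diagonal (fun i => l i * Real.exp (l i * t)) * kᵀ) t := by
  refine HasMatDeriv.mul_const (HasMatDeriv.const_mul k ?_) kᵀ
  intro i j
  by_cases hij : i = j
  · subst hij
    simp only [Matrix.diagonal_apply_eq]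
    have := ((hasDerivAt_id t).const_mul (l i)).exp
    simpa [mul_comm] using this
  · simpa [Matrix.diagonal_apply_ne _ hij] using hasDerivAt_const t (0 : ℝ)

theorem expCurve_zero (k : Matrix ι ι ℝ) (l : ι → ℝ) : expCurve k l 0 = k * kᵀ := by
  simp [expCurve]

theorem diagonal_exp_eq (l : ι → ℝ) (t : ℝ) :
    Matrix.diagonal (fun i => Real.exp (l i * t)) =
      Matrix.diagonal (fun i => Real.exp (l i * (t / 2))) *
        (Matrix.diagonal fun i => Real.exp (l i * (t / 2)))ᵀ := by
  rw [Matrix.diagonal_transpose, Matrix.diagonal_mul_diagonal]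
  congr 1
  funext i
  rw [← Real.exp_add]
  ring_nf

/-- Halving the exponents exhibits each point as a Gram matrix `g gᵀ`, that is, as the image of `1`
under a congruence. This is the source of every `t / 2` below. -/
theorem expCurve_eq_mul_transpose (k : Matrix ι ι ℝ) (l : ι → ℝ) (t : ℝ) :
    expCurve k l t = (k * Matrix.diagonal fun i => Real.exp (l i * (t / 2))) *
      (k * Matrix.diagonal fun i => Real.exp (l i * (t / 2)))ᵀ := by
  rw [expCurve, diagonal_exp_eq, Matrix.transpose_mul]
  simp only [Matrix.mul_assoc]

theorem det_diagonal_exp (l : ι → ℝ) (t : ℝ) :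
    (Matrix.diagonal fun i => Real.exp (l i * t)).det = Real.exp ((∑ i, l i) * t) := by
  rw [Matrix.det_diagonal, ← Real.exp_sum, Finset.sum_mul]

theorem preserves_diagonal_exp {p : Prop} {l : ι → ℝ} (hl : p → ∑ i, l i = 0) (t : ℝ) :
    Preserves p (Matrix.diagonal fun i => Real.exp (l i * t)) := by
  constructor
  · rw [det_diagonal_exp]
    exact (Real.exp_pos _).ne'
  · intro hp
    rw [det_diagonal_exp, hl hp]
    simp

theorem Preserves.mul {p : Prop} {g h : Matrix ι ι ℝ} (hg : Preserves p g) (hh : Preserves p h) :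
    Preserves p (g * h) := by
  constructor
  · rw [Matrix.det_mul]
    exact mul_ne_zero hg.det_ne hh.det_ne
  · intro hp
    rw [Matrix.det_mul, mul_pow, hg.det_sq hp, hh.det_sq hp, one_mul]

theorem one_mem_slice {p : Prop} : (1 : Matrix ι ι ℝ) ∈ slice p ι :=
  ⟨Matrix.PosDef.one, fun _ => Matrix.det_one⟩

theorem mul_transpose_mem_slice {p : Prop} {k : Matrix ι ι ℝ} (hk : Preserves p k) :
    k * kᵀ ∈ slice p ι := by
  simpa using slice_congr hk one_mem_slice

theorem expCurve_mem {p : Prop} {k : Matrix ι ι ℝ} {l : ι → ℝ} (hk : Preserves p k)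
    (hl : p → ∑ i, l i = 0) (t : ℝ) : expCurve k l t ∈ slice p ι := by
  rw [expCurve_eq_mul_transpose]
  exact mul_transpose_mem_slice (hk.mul (preserves_diagonal_exp hl _))

theorem expCurve_velocity (k : Matrix ι ι ℝ) (l : ι → ℝ) (t : ℝ) :
    velocity (expCurve k l) t =
      k * Matrix.diagonal (fun i => l i * Real.exp (l i * t)) * kᵀ :=
  (expCurve_hasMatDeriv k l t).velocity_eq

theorem diagonal_exp_inv (l : ι → ℝ) (t : ℝ) :
    (Matrix.diagonal fun i => Real.exp (l i * t))⁻¹ =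
      Matrix.diagonal fun i => (Real.exp (l i * t))⁻¹ := by
  refine Matrix.inv_eq_right_inv ?_
  rw [Matrix.diagonal_mul_diagonal]
  simp [(Real.exp_pos _).ne']

/-- The exponential factors cancel, so the speed is constant. -/
theorem metric_expCurve {k : Matrix ι ι ℝ} (hk : IsUnit k.det) (l : ι → ℝ) (t : ℝ) :
    metric (expCurve k l t) (velocity (expCurve k l) t) (velocity (expCurve k l) t) =
      ∑ i, l i ^ 2 := by
  rw [expCurve_velocity, expCurve, metric_congr hk]
  rw [metric, diagonal_exp_inv]
  simp only [Matrix.diagonal_mul_diagonal, Matrix.trace_diagonal]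
  refine Finset.sum_congr rfl fun i _ => ?_
  have := (Real.exp_pos (l i * t)).ne'
  field_simp

theorem length_expCurve {k : Matrix ι ι ℝ} (hk : IsUnit k.det) (l : ι → ℝ) :
    length (expCurve k l) = √(∑ i, l i ^ 2) := by
  simp [length, metric_expCurve hk]

/-- The integrand of `length`. -/
noncomputable def speed (c : ℝ → Matrix ι ι ℝ) (t : ℝ) : ℝ :=
  √(metric (c t) (velocity c t) (velocity c t))

theorem continuousOn_speed {c : ℝ → Matrix ι ι ℝ} (hc : ∀ i j, ContDiff ℝ 1 fun t => c t i j)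
    {s : Set ℝ} (hs : ∀ t ∈ s, (c t).PosDef) : ContinuousOn (speed c) s := by
  have h1 : Continuous c := continuous_matrix fun i j => (hc i j).continuous
  have h2 : Continuous (velocity c) :=
    continuous_matrix fun i j => (hc i j).continuous_deriv le_rfl
  have h3 : ContinuousOn (fun t => (c t)⁻¹) s := by
    simp only [Matrix.inv_def]
    have h0 : ContinuousOn (fun t => Ring.inverse (c t).det) s := by
      simp only [Ring.inverse_eq_inv']
      exact h1.matrix_det.continuousOn.inv₀ fun t ht => (hs t ht).det_pos.ne'
    exact h0.smul h1.matrix_adjugate.continuousOn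
  refine Real.continuous_sqrt.comp_continuousOn ?_
  unfold metric
  have h4 : ContinuousOn (fun t => velocity c t * (c t)⁻¹ * velocity c t * (c t)⁻¹) s :=
    ((h2.continuousOn.mul h3).mul h2.continuousOn).mul h3
  exact (continuous_id.matrix_trace).comp_continuousOn h4

theorem speed_nonneg (c : ℝ → Matrix ι ι ℝ) (t : ℝ) : 0 ≤ speed c t := Real.sqrt_nonneg _

theorem velocity_symm {c : ℝ → Matrix ι ι ℝ} {t : ℝ} (h : ∀ᶠ s in 𝓝 t, (c s).PosDef) :
    (velocity c t)ᵀ = velocity c t := by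
  ext i j
  refine Filter.EventuallyEq.deriv_eq ?_
  filter_upwards [h] with s hs
  have := congrFun (congrFun hs.1.eq i) j
  simpa using this

end

/-! ### The Riemannian distance: invariance, triangle inequality, lower and upper bounds. -/

section

variable {ι : Type*} [Fintype ι] [DecidableEq ι]

/-- `c` is one of the curves that compete in the definition of `rho S X Y`. -/
structure IsPath (S : Set (Matrix ι ι ℝ)) (X Y : Matrix ι ι ℝ) (c : ℝ → Matrix ι ι ℝ) : Prop where
  contDiff : ∀ i j, ContDiff ℝ 1 fun t => c t i j
  mem : ∀ t ∈ Set.Icc (0 : ℝ) 1, c t ∈ S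
  source : c 0 = X
  target : c 1 = Y

variable {p : Prop} {S : Set (Matrix ι ι ℝ)} {X Y Z : Matrix ι ι ℝ} {c : ℝ → Matrix ι ι ℝ}

theorem rho_eq (S : Set (Matrix ι ι ℝ)) (X Y : Matrix ι ι ℝ) :
    rho S X Y = sInf {l | ∃ c, IsPath S X Y c ∧ l = length c} := by
  unfold rho
  congr 1
  ext l
  exact ⟨fun ⟨c, h1, h2, h3, h4, h5⟩ => ⟨c, ⟨h1, h2, h3, h4⟩, h5⟩,
    fun ⟨c, h, h5⟩ => ⟨c, h.1, h.2, h.3, h.4, h5⟩⟩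

theorem length_nonneg (c : ℝ → Matrix ι ι ℝ) : 0 ≤ length c :=
  intervalIntegral.integral_nonneg zero_le_one fun t _ => speed_nonneg c t

theorem rho_nonneg (S : Set (Matrix ι ι ℝ)) (X Y : Matrix ι ι ℝ) : 0 ≤ rho S X Y := by
  rw [rho_eq]
  refine Real.sInf_nonneg ?_
  rintro _ ⟨c, -, rfl⟩
  exact length_nonneg c

theorem IsPath.rho_le (h : IsPath S X Y c) : rho S X Y ≤ length c := by
  rw [rho_eq]
  refine csInf_le ⟨0, ?_⟩ ⟨c, h, rfl⟩
  rintro _ ⟨c, -, rfl⟩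
  exact length_nonneg c

theorem expCurve_isPath {k : Matrix ι ι ℝ} {l : ι → ℝ} (hk : Preserves p k)
    (hl : p → ∑ i, l i = 0) :
    IsPath (slice p ι) (k * kᵀ) (expCurve k l 1) (expCurve k l) :=
  ⟨expCurve_contDiff k l 1, fun t _ => expCurve_mem hk hl t, expCurve_zero k l, rfl⟩

/-- Two points of a slice are joined by a geodesic. -/
theorem exists_expCurve (hX : X ∈ slice p ι) (hY : Y ∈ slice p ι) :
    ∃ (k : Matrix ι ι ℝ) (l : ι → ℝ), Preserves p k ∧ (p → ∑ i, l i = 0) ∧ X = k * kᵀ ∧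
      Y = expCurve k l 1 := by
  obtain ⟨k, d, hk, hd⟩ := exists_simultaneous_diag hX.1 (transpose_eq_of_mem hY)
  have hp := preserves_of_mul_transpose hX hk
  have hD : Matrix.diagonal d ∈ slice p ι := by
    have := slice_congr hp.inv hY
    rwa [hd, congr_inv_congr hp.isUnit] at this
  have hpos : ∀ i, 0 < d i := Matrix.posDef_diagonal_iff.1 hD.1
  refine ⟨k, fun i => Real.log (d i), hp, fun h => ?_, hk, ?_⟩
  · have := hD.2 h
    rw [Matrix.det_diagonal] at this
    rw [← Real.log_prod fun i _ => (hpos i).ne', this, Real.log_one]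
  · rw [hd, expCurve]
    congr 3
    funext i
    rw [mul_one, Real.exp_log (hpos i)]

theorem exists_isPath (hX : X ∈ slice p ι) (hY : Y ∈ slice p ι) :
    ∃ c, IsPath (slice p ι) X Y c := by
  obtain ⟨k, l, hk, hl, rfl, rfl⟩ := exists_expCurve hX hY
  exact ⟨_, expCurve_isPath hk hl⟩

theorem exists_isPath_length_lt (hX : X ∈ slice p ι) (hY : Y ∈ slice p ι) {r : ℝ}
    (hr : rho (slice p ι) X Y < r) : ∃ c, IsPath (slice p ι) X Y c ∧ length c < r := by
  rw [rho_eq] at hr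
  obtain ⟨c, hc⟩ := exists_isPath hX hY
  obtain ⟨_, ⟨c, hc, rfl⟩, h⟩ := exists_lt_of_csInf_lt
    (s := {l | ∃ c, IsPath (slice p ι) X Y c ∧ l = length c}) ⟨length c, c, hc, rfl⟩ hr
  exact ⟨c, hc, h⟩

/-- Relies on the existence of a connecting path: the real infimum of the empty set would be 0. -/
theorem le_rho (hX : X ∈ slice p ι) (hY : Y ∈ slice p ι) {r : ℝ}
    (h : ∀ c, IsPath (slice p ι) X Y c → r ≤ length c) : r ≤ rho (slice p ι) X Y := by
  by_contra! hlt
  obtain ⟨c, hc, hl⟩ := exists_isPath_length_lt hX hY hlt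
  exact (h c hc).not_gt hl

theorem rho_congr_le {h : Matrix ι ι ℝ} (hh : Preserves p h) (hX : X ∈ slice p ι)
    (hY : Y ∈ slice p ι) :
    rho (slice p ι) (h * X * hᵀ) (h * Y * hᵀ) ≤ rho (slice p ι) X Y := by
  refine le_rho hX hY fun c hc => ?_
  have hd : ∀ t, HasMatDeriv (fun s => h * c s * hᵀ) (h * velocity c t * hᵀ) t := fun t =>
    ((hasMatDeriv_velocity hc.contDiff one_ne_zero t).const_mul h).mul_const hᵀ
  have hpath : IsPath (slice p ι) (h * X * hᵀ) (h * Y * hᵀ) fun t => h * c t * hᵀ := by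
    refine ⟨fun i j => ?_, fun t ht => slice_congr hh (hc.mem t ht), ?_, ?_⟩
    · simp only [Matrix.mul_apply]
      exact ContDiff.sum fun x _ => (ContDiff.sum fun y _ =>
        contDiff_const.mul (hc.contDiff y x)).mul contDiff_const
    · simp only [hc.source]
    · simp only [hc.target]
  refine hpath.rho_le.trans_eq ?_
  unfold length
  simp only [(hd _).velocity_eq, metric_congr hh.isUnit]

theorem rho_congr {h : Matrix ι ι ℝ} (hh : Preserves p h) (hX : X ∈ slice p ι)
    (hY : Y ∈ slice p ι) :
    rho (slice p ι) (h * X * hᵀ) (h * Y * hᵀ) = rho (slice p ι) X Y := by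
  refine (rho_congr_le hh hX hY).antisymm ?_
  have := rho_congr_le hh.inv (slice_congr hh hX) (slice_congr hh hY)
  rwa [congr_inv_congr hh.isUnit, congr_inv_congr hh.isUnit] at this

theorem speed_scomp {c : ℝ → Matrix ι ι ℝ} (hc : ∀ i j, ContDiff ℝ 1 fun t => c t i j)
    {f : ℝ → ℝ} {a t : ℝ} (hf : HasDerivAt f a t) :
    speed (fun s => c (f s)) t = |a| * speed c (f t) := by
  have := ((hasMatDeriv_velocity hc one_ne_zero (f t)).scomp hf).velocity_eq
  rw [speed, this, metric_smul, Real.sqrt_mul (sq_nonneg a), Real.sqrt_sq_eq_abs, speed]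

theorem rho_comm_le (hX : X ∈ slice p ι) (hY : Y ∈ slice p ι) :
    rho (slice p ι) Y X ≤ rho (slice p ι) X Y := by
  refine le_rho hX hY fun c hc => ?_
  have hf : ∀ t : ℝ, HasDerivAt (fun s : ℝ => 1 - s) (-1) t := fun t => by
    simpa using (hasDerivAt_id t).const_sub 1
  have hpath : IsPath (slice p ι) Y X fun t => c (1 - t) := by
    refine ⟨fun i j => (hc.contDiff i j).comp (contDiff_const.sub contDiff_id),
      fun t ht => hc.mem _ ⟨by linarith [ht.2], by linarith [ht.1]⟩, ?_, ?_⟩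
    · simpa using hc.target
    · simpa using hc.source
  refine hpath.rho_le.trans_eq ?_
  change ∫ t in (0 : ℝ)..1, speed (fun s => c (1 - s)) t = ∫ t in (0 : ℝ)..1, speed c t
  simp only [speed_scomp hc.contDiff (hf _), abs_neg, abs_one, one_mul]
  rw [intervalIntegral.integral_comp_sub_left (fun t => speed c t) 1]
  simp

theorem rho_comm (hX : X ∈ slice p ι) (hY : Y ∈ slice p ι) :
    rho (slice p ι) X Y = rho (slice p ι) Y X :=
  (rho_comm_le hY hX).antisymm (rho_comm_le hX hY)

/-- The length does not depend on the parametrization. -/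
theorem integral_speed_scomp (hc : IsPath (slice p ι) X Y c) {f : ℝ → ℝ} (hf : ContDiff ℝ 1 f)
    (hmono : Monotone f) {a b : ℝ} (ha : f a = 0) (hb : f b = 1) (hab : a ≤ b) :
    ∫ t in a..b, speed (fun s => c (f s)) t = length c := by
  have hd : ∀ t, HasDerivAt f (deriv f t) t := fun t =>
    (hf.differentiable one_ne_zero t).hasDerivAt
  have hnn : ∀ t, 0 ≤ deriv f t := fun t => hmono.deriv_nonneg
  have himg : f '' Set.uIcc a b ⊆ Set.Icc 0 1 := by
    rw [Set.uIcc_of_le hab]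
    rintro _ ⟨t, ht, rfl⟩
    exact ⟨ha ▸ hmono ht.1, hb ▸ hmono ht.2⟩
  have key := intervalIntegral.integral_comp_mul_deriv'' (f := f) (f' := deriv f) (g := speed c)
    (a := a) (b := b) hf.continuous.continuousOn (fun t _ => (hd t).hasDerivWithinAt)
    (hf.continuous_deriv le_rfl).continuousOn
    (continuousOn_speed hc.contDiff fun t ht => (hc.mem t (himg ht)).1)
  rw [ha, hb] at key
  change _ = ∫ t in (0 : ℝ)..1, speed c t
  rw [← key]
  refine intervalIntegral.integral_congr fun t _ => ?_
  simp only [Function.comp_apply]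
  rw [speed_scomp hc.contDiff (hd t), abs_of_nonneg (hnn t), mul_comm]

theorem speed_congr {c d : ℝ → Matrix ι ι ℝ} {t : ℝ} (h : c =ᶠ[𝓝 t] d) : speed c t = speed d t := by
  have hv : velocity c t = velocity d t := by
    ext i j
    refine Filter.EventuallyEq.deriv_eq ?_
    filter_upwards [h] with s hs
    rw [hs]
  rw [speed, speed, hv, h.eq_of_nhds]

theorem rho_triangle (hX : X ∈ slice p ι) (hY : Y ∈ slice p ι) (hZ : Z ∈ slice p ι) :
    rho (slice p ι) X Z ≤ rho (slice p ι) X Y + rho (slice p ι) Y Z := by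
  refine le_of_forall_pos_le_add fun ε hε => ?_
  obtain ⟨c, hc, hcl⟩ := exists_isPath_length_lt hX hY
    (lt_add_of_pos_right (rho (slice p ι) X Y) (half_pos hε))
  obtain ⟨d, hd, hdl⟩ := exists_isPath_length_lt hY hZ
    (lt_add_of_pos_right (rho (slice p ι) Y Z) (half_pos hε))
  -- Competing curves are `C¹`, so both pieces are reparametrized to come to rest at the junction `1
  -- / 2`.
  let f : ℝ → ℝ := fun t => Real.smoothTransition (2 * t)
  let g : ℝ → ℝ := fun t => Real.smoothTransition (2 * t - 1)
  have hφ : ContDiff ℝ 1 Real.smoothTransition := Real.smoothTransition.contDiff (n := 1)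
  have hf : ContDiff ℝ 1 f := hφ.comp (contDiff_const.mul contDiff_id)
  have hg : ContDiff ℝ 1 g := hφ.comp ((contDiff_const.mul contDiff_id).sub contDiff_const)
  have hfm : Monotone f := fun s t hst => Real.smoothTransition.monotone (by linarith)
  have hgm : Monotone g := fun s t hst => Real.smoothTransition.monotone (by linarith)
  have hf1 : ∀ t, 1 / 2 ≤ t → f t = 1 := fun t ht =>
    Real.smoothTransition.one_of_one_le (by linarith)
  have hg0 : ∀ t, t ≤ 1 / 2 → g t = 0 := fun t ht =>
    Real.smoothTransition.zero_of_nonpos (by linarith)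
  have hf0 : f 0 = 0 := Real.smoothTransition.zero_of_nonpos (by simp)
  have hg1 : g 1 = 1 := Real.smoothTransition.one_of_one_le (by norm_num)
  -- On each half one of the two summands rests at `Y`; this single formula makes the concatenation
  -- visibly `C¹`.
  let e : ℝ → Matrix ι ι ℝ := fun t => c (f t) + d (g t) - Y
  have he1 : ∀ t, t ≤ 1 / 2 → e t = c (f t) := fun t ht => by
    simp only [e, hg0 t ht, hd.source, add_sub_cancel_right]
  have he2 : ∀ t, 1 / 2 ≤ t → e t = d (g t) := fun t ht => by
    simp only [e, hf1 t ht, hc.target, add_sub_cancel_left]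
  have hpath : IsPath (slice p ι) X Z e := by
    refine ⟨fun i j => ?_, fun t ht => ?_, ?_, ?_⟩
    · exact (((hc.contDiff i j).comp hf).add ((hd.contDiff i j).comp hg)).sub contDiff_const
    · rcases le_total t (1 / 2) with h | h
      · rw [he1 t h]
        exact hc.mem _ ⟨Real.smoothTransition.nonneg _, Real.smoothTransition.le_one _⟩
      · rw [he2 t h]
        exact hd.mem _ ⟨Real.smoothTransition.nonneg _, Real.smoothTransition.le_one _⟩
    · rw [he1 0 (by norm_num), hf0, hc.source]
    · rw [he2 1 (by norm_num), hg1, hd.target]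
  have hint : IntervalIntegrable (speed e) MeasureTheory.volume 0 1 := by
    refine ContinuousOn.intervalIntegrable ?_
    rw [Set.uIcc_of_le zero_le_one]
    exact continuousOn_speed hpath.contDiff fun t ht => (hpath.mem t ht).1
  have hL : length e = length c + length d := by
    change ∫ t in (0 : ℝ)..1, speed e t = _
    rw [← intervalIntegral.integral_add_adjacent_intervals (b := 1 / 2)
      (hint.mono_set (Set.uIcc_subset_uIcc_left (by rw [Set.uIcc_of_le] <;> norm_num)))
      (hint.mono_set (Set.uIcc_subset_uIcc_right (by rw [Set.uIcc_of_le] <;> norm_num)))]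
    congr 1
    · rw [← integral_speed_scomp hc hf hfm hf0 (hf1 _ le_rfl) (by norm_num)]
      refine intervalIntegral.integral_congr_Ioo_of_le (by norm_num) fun t ht => speed_congr ?_
      -- The speed involves a derivative, so the curves must agree near `t`; hence the open
      -- interval.
      filter_upwards [Iio_mem_nhds ht.2] with s hs using he1 s (le_of_lt hs)
    · rw [← integral_speed_scomp hd hg hgm (hg0 _ le_rfl) hg1 (by norm_num)]
      refine intervalIntegral.integral_congr_Ioo_of_le (by norm_num) fun t ht => speed_congr ?_
      filter_upwards [Ioi_mem_nhds ht.1] with s hs using he2 s (le_of_lt hs)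
  have := hpath.rho_le
  linarith

theorem dotProduct_pos (hX : X.PosDef) {v : ι → ℝ} (hv : v ≠ 0) : 0 < v ⬝ᵥ X *ᵥ v := by
  simpa using hX.dotProduct_mulVec_pos hv

/-- The logarithms of the values of positive definite forms at a vector are `1`-Lipschitz. -/
theorem abs_log_sub_log_le_rho (hX : X ∈ slice p ι) (hY : Y ∈ slice p ι) {v : ι → ℝ}
    (hv : v ≠ 0) :
    |Real.log (v ⬝ᵥ X *ᵥ v) - Real.log (v ⬝ᵥ Y *ᵥ v)| ≤ rho (slice p ι) X Y := by
  refine le_rho hX hY fun c hc => ?_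
  have hpos : ∀ t ∈ Set.Icc (0 : ℝ) 1, 0 < v ⬝ᵥ c t *ᵥ v := fun t ht =>
    dotProduct_pos (hc.mem t ht).1 hv
  let q' : ℝ → ℝ := fun t => v ⬝ᵥ velocity c t *ᵥ v
  have hd : ∀ t ∈ Set.uIcc (0 : ℝ) 1, HasDerivAt (fun t => Real.log (v ⬝ᵥ c t *ᵥ v))
      (q' t / (v ⬝ᵥ c t *ᵥ v)) t := by
    intro t ht
    rw [Set.uIcc_of_le zero_le_one] at ht
    exact ((hasMatDeriv_velocity hc.contDiff one_ne_zero t).dotProduct v).log (hpos t ht).ne'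
  have hcont : ContinuousOn (fun t => q' t / (v ⬝ᵥ c t *ᵥ v)) (Set.uIcc (0 : ℝ) 1) := by
    rw [Set.uIcc_of_le zero_le_one]
    have h1 : Continuous c := continuous_matrix fun i j => (hc.contDiff i j).continuous
    have h2 : Continuous (velocity c) :=
      continuous_matrix fun i j => (hc.contDiff i j).continuous_deriv le_rfl
    exact ((continuous_const.dotProduct (h2.matrix_mulVec continuous_const)).continuousOn).div
      ((continuous_const.dotProduct (h1.matrix_mulVec continuous_const)).continuousOn)
      fun t ht => (hpos t ht).ne'
  have hftc := intervalIntegral.integral_eq_sub_of_hasDerivAt hd hcont.intervalIntegrable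
  rw [hc.source, hc.target] at hftc
  rw [abs_sub_comm, ← hftc]
  refine (intervalIntegral.abs_integral_le_integral_abs zero_le_one).trans ?_
  refine intervalIntegral.integral_mono_on_of_le_Ioo zero_le_one
    hcont.intervalIntegrable.abs ?_ fun t ht => ?_
  · refine ContinuousOn.intervalIntegrable ?_
    rw [Set.uIcc_of_le zero_le_one]
    exact continuousOn_speed hc.contDiff fun t ht => (hc.mem t ht).1
  -- The velocity is known to be symmetric only where the curve is positive definite nearby, that
  -- is, inside `(0, 1)`.
  · have hmem : ∀ᶠ s in 𝓝 t, (c s).PosDef := by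
      filter_upwards [Icc_mem_nhds ht.1 ht.2] with s hs using (hc.mem s hs).1
    have hP := hmem.self_of_nhds
    have hq := dotProduct_pos hP hv
    rw [abs_div, abs_of_pos hq, div_le_iff₀ hq]
    refine abs_le_of_sq_le_sq ?_ (mul_nonneg (Real.sqrt_nonneg _) hq.le)
    rw [mul_pow, Real.sq_sqrt (metric_self_nonneg hP (velocity_symm hmem)), mul_comm]
    exact sq_dotProduct_le_metric hP (velocity_symm hmem) v

theorem rho_expCurve_le {k : Matrix ι ι ℝ} {l : ι → ℝ} (hk : Preserves p k)
    (hl : p → ∑ i, l i = 0) :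
    rho (slice p ι) (k * kᵀ) (expCurve k l 1) ≤ √(∑ i, l i ^ 2) :=
  (expCurve_isPath hk hl).rho_le.trans_eq (length_expCurve hk.isUnit l)

theorem rho_self (hX : X ∈ slice p ι) : rho (slice p ι) X X = 0 := by
  refine le_antisymm ?_ (rho_nonneg _ _ _)
  obtain ⟨k, hk⟩ := exists_mul_transpose hX.1
  have := rho_expCurve_le (l := 0) (preserves_of_mul_transpose hX hk) (by simp)
  have h2 : expCurve k 0 1 = X := by simp [expCurve, hk]
  rw [h2, ← hk] at this
  simpa using this

/-- From `1 - x⁻¹ ≤ log x ≤ x - 1`, with `x⁻¹ ≤ 2` because `x ≥ 1 / 2`. -/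
theorem sq_log_le {x : ℝ} (hx : |x - 1| ≤ 1 / 2) : Real.log x ^ 2 ≤ 4 * (x - 1) ^ 2 := by
  have h := abs_le.1 hx
  have hx0 : 0 < x := by linarith
  have h1 := Real.log_le_sub_one_of_pos hx0
  have h2 := Real.one_sub_inv_le_log_of_pos hx0
  have h3 : |Real.log x| ≤ |2 * (x - 1)| := by
    have h4 : |1 - x⁻¹| ≤ |2 * (x - 1)| := by
      have : 1 - x⁻¹ = (x - 1) * x⁻¹ := by field_simp
      rw [this, mul_comm 2, abs_mul, abs_mul]
      gcongr
      exact inv_le_of_inv_le₀ two_pos (by linarith)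
    have h5 : |x - 1| ≤ |2 * (x - 1)| := by
      rw [abs_mul, abs_two]
      linarith [abs_nonneg (x - 1)]
    refine abs_le.2 ⟨?_, ?_⟩
    · linarith [neg_abs_le (1 - x⁻¹)]
    · linarith [le_abs_self (x - 1)]
  have := sq_le_sq.2 h3
  linarith

/-- The diagonalizing `k` is orthogonal here, so the Frobenius norm of `X - 1` is that of the
eigenvalues minus 1, while the geodesic from `1` to `X` has the norm of their logarithms as its
length. -/
theorem rho_one_le (hX : X ∈ slice p ι) (h : ∑ i, ∑ j, (X - 1) i j ^ 2 ≤ 1 / 4) :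
    rho (slice p ι) 1 X ≤ √(4 * ∑ i, ∑ j, (X - 1) i j ^ 2) := by
  obtain ⟨k, l, hk, hl, h1, hX'⟩ := exists_expCurve one_mem_slice hX
  have hkk : kᵀ * k = 1 := mul_eq_one_comm.1 h1.symm
  set D := Matrix.diagonal fun i => Real.exp (l i * 1) with hD
  have hsum : ∑ i, ∑ j, (X - 1) i j ^ 2 = ∑ i, (Real.exp (l i) - 1) ^ 2 := by
    rw [← trace_mul_self_of_symm (by simp [transpose_eq_of_mem hX])]
    have e1 : X - 1 = k * (D - 1) * kᵀ := by
      rw [hX', expCurve, ← hD, Matrix.mul_sub, Matrix.sub_mul, Matrix.mul_one, ← h1]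
    have e2 : (X - 1) * (X - 1) = k * ((D - 1) * (D - 1)) * kᵀ := by
      rw [e1]
      calc k * (D - 1) * kᵀ * (k * (D - 1) * kᵀ)
          = k * (D - 1) * (kᵀ * k) * ((D - 1) * kᵀ) := by simp only [Matrix.mul_assoc]
        _ = _ := by rw [hkk, Matrix.mul_one]; simp only [Matrix.mul_assoc]
    rw [e2, Matrix.trace_mul_comm, ← Matrix.mul_assoc, hkk, Matrix.one_mul, hD,
      ← Matrix.diagonal_one, Matrix.diagonal_sub, Matrix.diagonal_mul_diagonal,
      Matrix.trace_diagonal]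
    simp [sq]
  rw [hsum] at h ⊢
  have hle := rho_expCurve_le hk hl
  rw [← h1, ← hX'] at hle
  refine hle.trans (Real.sqrt_le_sqrt ?_)
  rw [Finset.mul_sum]
  refine Finset.sum_le_sum fun i hi => ?_
  have h2 : (Real.exp (l i) - 1) ^ 2 ≤ 1 / 4 :=
    (Finset.single_le_sum (f := fun i => (Real.exp (l i) - 1) ^ 2)
      (fun i _ => sq_nonneg _) hi).trans h
  have h3 : |Real.exp (l i) - 1| ≤ 1 / 2 := by
    refine abs_le_of_sq_le_sq (b := 1 / 2) ?_ (by norm_num)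
    linarith
  simpa using sq_log_le h3

/-- `rho` is continuous on the slices. -/
theorem tendsto_rho {β : Type*} {F : Filter β} {f : β → Matrix ι ι ℝ}
    (hf : ∀ᶠ b in F, f b ∈ slice p ι) (hX : X ∈ slice p ι) (h : Tendsto f F (𝓝 X)) :
    Tendsto (fun b => rho (slice p ι) X (f b)) F (𝓝 0) := by
  obtain ⟨k, hk⟩ := exists_mul_transpose hX.1
  have hp := preserves_of_mul_transpose hX hk
  -- An isometry moves `X` to the base point `1`.
  let g : β → Matrix ι ι ℝ := fun b => k⁻¹ * f b * k⁻¹ᵀ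
  have hg1 : Tendsto g F (𝓝 1) := by
    have hc : Continuous fun A : Matrix ι ι ℝ => k⁻¹ * A * k⁻¹ᵀ := by fun_prop
    have h1 := (hc.tendsto X).comp h
    have h2 : k⁻¹ * X * k⁻¹ᵀ = 1 := by
      have := congr_inv_congr hp.isUnit 1
      rwa [Matrix.mul_one, ← hk] at this
    rwa [h2] at h1
  have hs : Tendsto (fun b => ∑ i, ∑ j, (g b - 1) i j ^ 2) F (𝓝 0) := by
    have hc : Continuous fun A : Matrix ι ι ℝ => ∑ i, ∑ j, (A - 1) i j ^ 2 := by
      refine continuous_finsetSum _ fun i _ => continuous_finsetSum _ fun j _ => ?_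
      exact ((continuous_id.sub continuous_const).matrix_elem i j).pow 2
    have := (hc.tendsto 1).comp hg1
    simpa [Function.comp_def] using this
  have hs2 : Tendsto (fun b => √(4 * ∑ i, ∑ j, (g b - 1) i j ^ 2)) F (𝓝 0) := by
    have := (hs.const_mul 4).sqrt
    simpa using this
  refine tendsto_of_tendsto_of_tendsto_of_le_of_le' tendsto_const_nhds hs2
    (Eventually.of_forall fun b => rho_nonneg _ _ _) ?_
  filter_upwards [hs.eventually_le_const (show (0 : ℝ) < 1 / 4 by norm_num), hf] with b hb hfb
  have hgb : g b ∈ slice p ι := slice_congr hp.inv hfb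
  have h1 := rho_congr hp one_mem_slice hgb
  rw [congr_congr_inv hp.isUnit, Matrix.mul_one, ← hk] at h1
  rw [h1]
  exact rho_one_le hgb hb

end

/-! ### Tangent vectors and the classification of geodesics. -/

section

variable {ι : Type*} [Fintype ι] [DecidableEq ι]

variable {p : Prop} {X Y W V : Matrix ι ι ℝ} {μ : ℝ → Matrix ι ι ℝ}

theorem mem_tangentTo (hX : X ∈ slice p ι) (hW : Wᵀ = W) (h : p → (X⁻¹ * W).trace = 0) :
    W ∈ tangentTo (slice p ι) X := by
  obtain ⟨k, l, hk, hl⟩ := exists_simultaneous_diag hX.1 hW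
  have hp := preserves_of_mul_transpose hX hk
  have hsum : p → ∑ i, l i = 0 := fun hpp => by
    rw [← trace_inv_mul_diag hp.isUnit, ← hk, ← hl, h hpp]
  refine ⟨expCurve k l, by rw [expCurve_zero, hk],
    Eventually.of_forall fun s => expCurve_mem hp hsum s, ?_⟩
  have := expCurve_hasMatDeriv k l 0
  simp only [mul_zero, Real.exp_zero, mul_one] at this
  rwa [← hl] at this

/-- An arithmetic–geometric mean inequality, obtained by summing `1 + x ≤ exp x` over exponents of
sum zero. -/
theorem card_le_trace_inv_mul (hp : p) (hX : X ∈ slice p ι) (hY : Y ∈ slice p ι) :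
    (Fintype.card ι : ℝ) ≤ (X⁻¹ * Y).trace := by
  obtain ⟨k, l, hk, hl, rfl, rfl⟩ := exists_expCurve hX hY
  rw [expCurve, trace_inv_mul_diag hk.isUnit]
  have h : ∑ i, (l i * 1 + 1) ≤ ∑ i, Real.exp (l i * 1) :=
    Finset.sum_le_sum fun i _ => Real.add_one_le_exp _
  simpa [Finset.sum_add_distrib, hl hp] using h

/-- By `card_le_trace_inv_mul`, `s ↦ tr (μ(t)⁻¹ μ(s))` is minimal at `s = t`, so no determinant has
to be differentiated. -/
theorem trace_inv_mul_velocity (hp : p) {t : ℝ} (hμ : ∀ s, μ s ∈ slice p ι)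
    (hV : HasMatDeriv μ V t) : ((μ t)⁻¹ * V).trace = 0 := by
  have hd := (hV.const_mul (μ t)⁻¹).trace
  refine IsLocalMin.hasDerivAt_eq_zero (Eventually.of_forall fun s => ?_) hd
  simp only [Matrix.nonsing_inv_mul _ (isUnit_det (hμ t)), Matrix.trace_one]
  exact card_le_trace_inv_mul hp (hμ t) (hμ s)

theorem velocity_transpose {c : ℝ → Matrix ι ι ℝ} (h : ∀ s, (c s)ᵀ = c s) (t : ℝ) :
    (velocity c t)ᵀ = velocity c t := by
  ext i j
  refine Filter.EventuallyEq.deriv_eq (Eventually.of_forall fun s => ?_)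
  exact congrFun (congrFun (h s) i) j

theorem hasDerivAt_metric_base (hX : IsUnit X.det) (V W : Matrix ι ι ℝ) :
    HasDerivAt (fun ε : ℝ => metric (X + ε • W) V V)
      (-2 * (V * X⁻¹ * V * X⁻¹ * W * X⁻¹).trace) 0 := by
  have h0 : HasMatDeriv (fun ε : ℝ => X + ε • W) W 0 := by
    intro i j
    simpa using ((hasDerivAt_id (0 : ℝ)).mul_const (W i j)).const_add (X i j)
  have hinv := h0.inv (by simpa using hX)
  have h1 := (((hinv.const_mul V).mul_const V).mul hinv).trace
  refine h1.congr_deriv ?_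
  symm
  simp only [zero_smul, add_zero, Matrix.trace_add, Matrix.mul_neg, Matrix.neg_mul,
    Matrix.trace_neg]
  have : (V * (X⁻¹ * W * X⁻¹) * V * X⁻¹).trace = (V * X⁻¹ * V * X⁻¹ * W * X⁻¹).trace := by
    rw [Matrix.mul_assoc, Matrix.trace_mul_comm]
    simp only [Matrix.mul_assoc]
  rw [this]
  simp only [Matrix.mul_assoc]
  ring

theorem hasDerivAt_metric_along {v : ℝ → Matrix ι ι ℝ} {U : Matrix ι ι ℝ} {t : ℝ}
    (hμ : HasMatDeriv μ (v t) t) (hv : HasMatDeriv v U t) (hX : IsUnit (μ t).det)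
    (W : Matrix ι ι ℝ) :
    HasDerivAt (fun s => metric (μ s) (v s) W)
      (((U - v t * (μ t)⁻¹ * v t) * (μ t)⁻¹ * W * (μ t)⁻¹).trace -
        (v t * (μ t)⁻¹ * v t * (μ t)⁻¹ * W * (μ t)⁻¹).trace) t := by
  have hinv := hμ.inv hX
  have h1 := (((hv.mul hinv).mul_const W).mul hinv).trace
  refine h1.congr_deriv ?_
  symm
  simp only [Matrix.trace_add, Matrix.mul_neg, Matrix.neg_mul, Matrix.trace_neg, Matrix.add_mul,
    Matrix.sub_mul, Matrix.trace_sub]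
  have : (v t * (μ t)⁻¹ * W * ((μ t)⁻¹ * v t * (μ t)⁻¹)).trace =
      (v t * (μ t)⁻¹ * v t * (μ t)⁻¹ * W * (μ t)⁻¹).trace := by
    rw [← Matrix.mul_assoc, ← Matrix.mul_assoc, Matrix.mul_assoc _ (v t), Matrix.trace_mul_comm]
    simp only [Matrix.mul_assoc]
  rw [this]
  simp only [Matrix.mul_assoc]
  ring

/-- The geodesic equation, in terms of the acceleration. -/
theorem geodesic_equation_iff {U : Matrix ι ι ℝ} {t : ℝ}
    (hμ : HasMatDeriv μ (velocity μ t) t) (hv : HasMatDeriv (velocity μ) U t)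
    (hX : IsUnit (μ t).det) (W : Matrix ι ι ℝ) :
    deriv (fun s => metric (μ s) (velocity μ s) W) t =
        1 / 2 * deriv (fun ε : ℝ => metric (μ t + ε • W) (velocity μ t) (velocity μ t)) 0 ↔
      ((U - velocity μ t * (μ t)⁻¹ * velocity μ t) * (μ t)⁻¹ * W * (μ t)⁻¹).trace = 0 := by
  rw [(hasDerivAt_metric_along hμ hv hX W).deriv,
    (hasDerivAt_metric_base hX (velocity μ t) W).deriv]
  constructor <;> intro h <;> linarith

theorem expCurve_injective_at {k : Matrix ι ι ℝ} (hk : IsUnit k.det) {l : ι → ℝ} {i : ι}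
    (hl : l i ≠ 0) : expCurve k l 0 ≠ expCurve k l 1 := by
  intro h
  have h2 : k⁻¹ * expCurve k l 0 * k⁻¹ᵀ = k⁻¹ * expCurve k l 1 * k⁻¹ᵀ := by rw [h]
  simp only [expCurve, congr_inv_congr hk] at h2
  have h3 := congrFun (Matrix.diagonal_injective h2) i
  simp only [mul_zero, Real.exp_zero, mul_one] at h3
  exact hl (Real.exp_eq_one_iff _ |>.1 h3.symm)

/-- The acceleration equals `V X⁻¹ V` exactly, so the geodesic equation holds against every `W`,
tangent or not. -/
theorem isGeodesic_expCurve {k : Matrix ι ι ℝ} {l : ι → ℝ} (hk : Preserves p k)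
    (hl : p → ∑ i, l i = 0) (hne : ∃ i, l i ≠ 0) : IsGeodesic (slice p ι) (expCurve k l) := by
  refine ⟨expCurve_contDiff k l ∞, expCurve_mem hk hl, ?_, fun t W _ => ?_⟩
  · obtain ⟨i, hi⟩ := hne
    exact ⟨0, 1, expCurve_injective_at hk.isUnit hi⟩
  · have hv : HasMatDeriv (velocity (expCurve k l))
        (k * Matrix.diagonal (fun i => l i * (l i * Real.exp (l i * t))) * kᵀ) t := by
      rw [funext (expCurve_velocity k l)]
      refine HasMatDeriv.mul_const (HasMatDeriv.const_mul k ?_) kᵀ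
      intro i j
      by_cases hij : i = j
      · subst hij
        simp only [Matrix.diagonal_apply_eq]
        have := (((hasDerivAt_id t).const_mul (l i)).exp).const_mul (l i)
        simpa [mul_comm, mul_left_comm] using this
      · simpa [Matrix.diagonal_apply_ne _ hij] using hasDerivAt_const t (0 : ℝ)
    have hμ := expCurve_hasMatDeriv k l t
    rw [← expCurve_velocity] at hμ
    rw [geodesic_equation_iff hμ hv (isUnit_det (expCurve_mem hk hl t)),
      expCurve_velocity, expCurve, congr_mul_inv_congr hk.isUnit, diagonal_exp_inv]
    have : k * Matrix.diagonal (fun i => l i * (l i * Real.exp (l i * t))) * kᵀ -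
        k * (Matrix.diagonal (fun i => l i * Real.exp (l i * t)) *
          Matrix.diagonal fun i => (Real.exp (l i * t))⁻¹) * k⁻¹ *
          (k * Matrix.diagonal (fun i => l i * Real.exp (l i * t)) * kᵀ) = 0 := by
      rw [sub_eq_zero]
      calc _ = k * (Matrix.diagonal (fun i => l i * Real.exp (l i * t)) *
          (Matrix.diagonal fun i => (Real.exp (l i * t))⁻¹) *
            Matrix.diagonal (fun i => l i * Real.exp (l i * t))) * kᵀ := by
            rw [Matrix.diagonal_mul_diagonal, Matrix.diagonal_mul_diagonal]
            congr 3
            funext i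
            have := (Real.exp_pos (l i * t)).ne'
            field_simp
        _ = k * (Matrix.diagonal (fun i => l i * Real.exp (l i * t)) *
          Matrix.diagonal fun i => (Real.exp (l i * t))⁻¹) * (k⁻¹ * k) *
            Matrix.diagonal (fun i => l i * Real.exp (l i * t)) * kᵀ := by
            rw [Matrix.nonsing_inv_mul _ hk.isUnit]
            simp only [Matrix.mul_assoc, Matrix.one_mul]
        _ = _ := by simp only [Matrix.mul_assoc]
    rw [this]
    simp

/-- The solutions of `y' = a y`. -/
theorem eq_mul_exp_of_hasDerivAt {f : ℝ → ℝ} {a : ℝ} (h : ∀ t, HasDerivAt f (f t * a) t) (t : ℝ) :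
    f t = f 0 * Real.exp (a * t) := by
  have hd : ∀ t, HasDerivAt (fun s => f s * Real.exp (-(a * s))) 0 t := fun t => by
    have h2 := (((hasDerivAt_id t).const_mul a).neg).exp
    have := (h t).mul h2
    simp only [id] at this
    refine this.congr_deriv ?_
    simp only [Pi.neg_apply]
    ring
  have hc := is_const_of_deriv_eq_zero (fun t => (hd t).differentiableAt) (fun t => (hd t).deriv) t 0
  simp only [mul_zero, neg_zero, Real.exp_zero, mul_one] at hc
  rw [← hc, mul_assoc, ← Real.exp_add]
  simp

/-- The defect `P = U - V X⁻¹ V` is itself tangent to the slice. Testing the geodesic equation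
against `W = P` gives `P` norm zero, hence `P = 0`. -/
theorem acceleration_eq (hμ : IsGeodesic (slice p ι) μ) (t : ℝ) :
    HasMatDeriv (velocity μ) (velocity μ t * (μ t)⁻¹ * velocity μ t) t := by
  have hvel : ∀ t, HasMatDeriv μ (velocity μ t) t :=
    hasMatDeriv_velocity hμ.smooth (by simp)
  have hvs : ∀ i j, ContDiff ℝ ∞ fun t => velocity μ t i j := fun i j =>
    (contDiff_infty_iff_deriv.1 (hμ.smooth i j)).2
  have hacc := hasMatDeriv_velocity hvs (by simp) t
  set U := velocity (velocity μ) t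
  set V := velocity μ t with hV
  have hu := isUnit_det (hμ.mem t)
  have hVT : ∀ s, (velocity μ s)ᵀ = velocity μ s :=
    velocity_transpose fun s => transpose_eq_of_mem (hμ.mem s)
  have hUT : Uᵀ = U := velocity_transpose hVT t
  have hPT : (U - V * (μ t)⁻¹ * V)ᵀ = U - V * (μ t)⁻¹ * V := by
    rw [Matrix.transpose_sub, Matrix.transpose_mul, Matrix.transpose_mul, hUT, hV, hVT t,
      Matrix.transpose_nonsing_inv, transpose_eq_of_mem (hμ.mem t), Matrix.mul_assoc]
  -- This trace is the derivative of `tr (X⁻¹ V)`, which vanishes identically when the determinant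
  -- is 1.
  have htr : p → ((μ t)⁻¹ * (U - V * (μ t)⁻¹ * V)).trace = 0 := fun hp => by
    have h1 := (((hvel t).inv hu).mul hacc).trace
    have h2 : (fun s => ((μ s)⁻¹ * velocity μ s).trace) = fun _ => 0 :=
      funext fun s => trace_inv_mul_velocity hp hμ.mem (hvel s)
    rw [h2] at h1
    have h3 := h1.unique (hasDerivAt_const t 0)
    rw [← h3]
    simp only [Matrix.mul_sub, Matrix.trace_add, Matrix.trace_sub, Matrix.neg_mul,
      Matrix.trace_neg, Matrix.mul_assoc, hV]
    ring
  have htan := mem_tangentTo (hμ.mem t) hPT htr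
  have heq := (geodesic_equation_iff (hvel t) hacc hu _).1 (hμ.equation t _ htan)
  have hP := eq_zero_of_metric_self (hμ.mem t).1 hPT heq
  rw [sub_eq_zero] at hP
  rwa [← hP]

/-- Geodesics are the curves `k exp(t diag l) kᵀ`. -/
theorem isGeodesic_iff : IsGeodesic (slice p ι) μ ↔
    ∃ (k : Matrix ι ι ℝ) (l : ι → ℝ), Preserves p k ∧ (p → ∑ i, l i = 0) ∧ (∃ i, l i ≠ 0) ∧
      μ = expCurve k l := by
  constructor
  swap
  · rintro ⟨k, l, hk, hl, hne, rfl⟩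
    exact isGeodesic_expCurve hk hl hne
  intro hμ
  have hvel : ∀ t, HasMatDeriv μ (velocity μ t) t :=
    hasMatDeriv_velocity hμ.smooth (by simp)
  have hu : ∀ t, IsUnit (μ t).det := fun t => isUnit_det (hμ.mem t)
  -- `X⁻¹ V` is a conserved quantity, which reduces the equation to first order.
  have hconst : ∀ t, (μ t)⁻¹ * velocity μ t = (μ 0)⁻¹ * velocity μ 0 := by
    intro t
    have hd : ∀ t, HasMatDeriv (fun s => (μ s)⁻¹ * velocity μ s) 0 t := fun t => by
      have := ((hvel t).inv (hu t)).mul (acceleration_eq hμ t)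
      convert this using 1
      simp only [Matrix.neg_mul, Matrix.mul_assoc]
      simp
    ext i j
    exact is_const_of_deriv_eq_zero (fun t => (hd t i j).differentiableAt)
      (fun t => (hd t i j).deriv) t 0
  obtain ⟨k, l, hk, hl⟩ := exists_simultaneous_diag (hμ.mem 0).1
    (velocity_transpose (fun s => transpose_eq_of_mem (hμ.mem s)) 0)
  have hp := preserves_of_mul_transpose (hμ.mem 0) hk
  have hA : (μ 0)⁻¹ * velocity μ 0 = k⁻¹ᵀ * Matrix.diagonal l * kᵀ := by
    rw [hl, hk, mul_transpose_inv]
    calc k⁻¹ᵀ * k⁻¹ * (k * Matrix.diagonal l * kᵀ)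
        = k⁻¹ᵀ * (k⁻¹ * k) * Matrix.diagonal l * kᵀ := by simp only [Matrix.mul_assoc]
      _ = _ := by rw [Matrix.nonsing_inv_mul _ hp.isUnit, Matrix.mul_one]
  have hV : ∀ t, velocity μ t = μ t * (k⁻¹ᵀ * Matrix.diagonal l * kᵀ) := fun t => by
    rw [← hA, ← hconst t, ← Matrix.mul_assoc, Matrix.mul_nonsing_inv _ (hu t), Matrix.one_mul]
  -- In these coordinates the equation is `Z' = Z diag l` and decouples into scalar ones.
  let Z : ℝ → Matrix ι ι ℝ := fun t => k⁻¹ * μ t * k⁻¹ᵀ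
  have hZ : ∀ t, HasMatDeriv Z (Z t * Matrix.diagonal l) t := fun t => by
    have := ((hvel t).const_mul k⁻¹).mul_const k⁻¹ᵀ
    convert this using 1
    rw [hV]
    calc k⁻¹ * μ t * k⁻¹ᵀ * Matrix.diagonal l
        = k⁻¹ * μ t * k⁻¹ᵀ * Matrix.diagonal l * (kᵀ * k⁻¹ᵀ) := by
          rw [transpose_mul_inv_transpose hp.isUnit, Matrix.mul_one]
      _ = _ := by simp only [Matrix.mul_assoc]
  have hZ0 : Z 0 = 1 := by
    have := congr_inv_congr hp.isUnit 1
    rwa [Matrix.mul_one, ← hk] at this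
  have hZt : ∀ t, Z t = Matrix.diagonal fun i => Real.exp (l i * t) := fun t => by
    ext i j
    have h1 : ∀ t, HasDerivAt (fun s => Z s i j) (Z t i j * l j) t := fun t => by
      simpa [Matrix.mul_diagonal] using hZ t i j
    rw [eq_mul_exp_of_hasDerivAt h1 t, hZ0]
    by_cases hij : i = j
    · subst hij
      simp
    · simp [hij]
  have hμ' : μ = expCurve k l := by
    funext t
    rw [expCurve, ← hZt, congr_congr_inv hp.isUnit]
  refine ⟨k, l, hp, fun hpp => ?_, ?_, hμ'⟩
  · have := trace_inv_mul_velocity hpp hμ.mem (hvel 0)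
    rwa [hl, hk, trace_inv_mul_diag hp.isUnit] at this
  · by_contra! h0
    obtain ⟨s, t, hst⟩ := hμ.nonconstant
    refine hst ?_
    have : l = 0 := funext h0
    simp [hμ', expCurve, this]

end

/-! ### Triangular matrices: the curves `h γ hᵀ` belong to the pencils. -/

section

variable {ι : Type*} [Fintype ι] [DecidableEq ι]

variable {p : Prop} {X Y : Matrix ι ι ℝ} {h D k : Matrix ι ι ℝ} {l : ι → ℝ}

/-- The matrix `exp(t diag l)`. -/
noncomputable abbrev expDiag (l : ι → ℝ) (t : ℝ) : Matrix ι ι ℝ :=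
  Matrix.diagonal fun i => Real.exp (l i * t)

theorem expDiag_mul (l : ι → ℝ) (s t : ℝ) : expDiag l s * expDiag l t = expDiag l (s + t) := by
  rw [Matrix.diagonal_mul_diagonal]
  congr 1
  funext i
  rw [← Real.exp_add, mul_add]

theorem expCurve_one_left (l : ι → ℝ) (t : ℝ) : expCurve 1 l t = expDiag l t := by
  simp [expCurve]

theorem congr_expCurve (h k : Matrix ι ι ℝ) (l : ι → ℝ) (t : ℝ) :
    h * expCurve k l t * hᵀ = expCurve (h * k) l t := by
  simp only [expCurve, Matrix.transpose_mul, Matrix.mul_assoc]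

/-- A change of scale is absorbed by the exponents and a shift by the left factor, so the family of
curves is closed under affine reparametrization. -/
theorem expCurve_affine (k : Matrix ι ι ℝ) (l : ι → ℝ) (a b s : ℝ) :
    expCurve (k * expDiag l (b / 2)) (a • l) s = expCurve k l (a * s + b) := by
  have : expDiag l (b / 2) * Matrix.diagonal (fun i => Real.exp ((a • l) i * s)) *
      (expDiag l (b / 2))ᵀ = expDiag l (a * s + b) := by
    rw [Matrix.diagonal_transpose, Matrix.diagonal_mul_diagonal, Matrix.diagonal_mul_diagonal]
    congr 1
    funext i
    rw [← Real.exp_add, ← Real.exp_add, Pi.smul_apply, smul_eq_mul]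
    ring_nf
  rw [← congr_expCurve, expCurve, this, expCurve]

theorem Preserves.one : Preserves p (1 : Matrix ι ι ℝ) := ⟨by simp, by simp⟩

/-- The speed of an exponential curve bounds the distances along it. -/
theorem rho_expCurve_expCurve_le (hk : Preserves p k) (hl : p → ∑ i, l i = 0) (s t : ℝ) :
    rho (slice p ι) (expCurve k l s) (expCurve k l t) ≤ √(∑ i, l i ^ 2) * |t - s| := by
  have hsum : p → ∑ i, ((t - s) • l) i = 0 := fun hp => by
    simp [← Finset.mul_sum, hl hp]
  have := rho_expCurve_le (hk.mul (preserves_diagonal_exp hl (s / 2))) hsum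
  rw [expCurve_affine, ← expCurve_eq_mul_transpose] at this
  ring_nf at this ⊢
  refine this.trans_eq ?_
  have h2 : ∑ i, ((t - s) • l) i ^ 2 = (∑ i, l i ^ 2) * (t - s) ^ 2 := by
    simp only [Pi.smul_apply, smul_eq_mul, mul_pow, Finset.sum_mul]
    exact Finset.sum_congr rfl fun i _ => by ring
  rw [h2, Real.sqrt_mul (Finset.sum_nonneg fun i _ => sq_nonneg _),
    Real.sqrt_sq_eq_abs]

theorem dotProduct_expCurve (k : Matrix ι ι ℝ) (l : ι → ℝ) (t : ℝ) (v : ι → ℝ) :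
    v ⬝ᵥ expCurve k l t *ᵥ v = ∑ i, (kᵀ *ᵥ v) i ^ 2 * Real.exp (l i * t) := by
  rw [expCurve, dotProduct_congr, dotProduct]
  refine Finset.sum_congr rfl fun i _ => ?_
  rw [Matrix.mulVec_diagonal]
  ring

theorem transpose_mulVec_single (k : Matrix ι ι ℝ) (i j : ι) :
    (kᵀ *ᵥ Pi.single i 1) j = k i j := by simp

theorem single_one_ne_zero (i : ι) : (Pi.single i 1 : ι → ℝ) ≠ 0 := by simp

theorem log_dotProduct_expCurve_one (l : ι → ℝ) (t : ℝ) (i : ι) :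
    Real.log ((Pi.single i 1 : ι → ℝ) ⬝ᵥ expCurve 1 l t *ᵥ Pi.single i 1) = l i * t := by
  simp [expCurve]

/-- An isometry reduces to `k = 1`, where the logarithm of the form at the `i`-th basis vector is `l
i * t`. -/
theorem le_rho_expCurve (hk : Preserves p k) (hl : p → ∑ i, l i = 0) (i : ι) (s t : ℝ) :
    |l i| * |s - t| ≤ rho (slice p ι) (expCurve k l s) (expCurve k l t) := by
  have h1 := rho_congr hk (expCurve_mem .one hl s) (expCurve_mem .one hl t)
  rw [congr_expCurve, congr_expCurve, Matrix.mul_one] at h1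
  rw [h1]
  have := abs_log_sub_log_le_rho (expCurve_mem (p := p) .one hl s) (expCurve_mem .one hl t)
    (single_one_ne_zero i)
  rwa [log_dotProduct_expCurve_one, log_dotProduct_expCurve_one, ← mul_sub, abs_mul] at this

theorem eq_of_rho_eq_zero (hX : X ∈ slice p ι) (hY : Y ∈ slice p ι)
    (h0 : rho (slice p ι) X Y = 0) : X = Y := by
  obtain ⟨k, l, hk, hl, rfl, rfl⟩ := exists_expCurve hX hY
  rw [← expCurve_zero k l] at h0 ⊢
  have : l = 0 := funext fun i => by
    have := le_rho_expCurve hk hl i 0 1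
    rw [h0] at this
    simpa using this
  simp [this, expCurve]

/-- The part of `h` within the blocks on which `l` is constant. -/
noncomputable def blockPart (l : ι → ℝ) (h : Matrix ι ι ℝ) : Matrix ι ι ℝ :=
  Matrix.of fun i j => if l i = l j then h i j else 0

/-- `h` is block triangular for the decreasing order of the values of `l`. -/
def IsTri (l : ι → ℝ) (h : Matrix ι ι ℝ) : Prop := ∀ i j, l i < l j → h i j = 0

/-- The conjugates of a block triangular matrix by `exp (-(t/2) diag l)`. -/
noncomputable def conjDiag (l : ι → ℝ) (h : Matrix ι ι ℝ) (t : ℝ) : Matrix ι ι ℝ :=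
  expDiag l (-(t / 2)) * h * expDiag l (t / 2)

/-- The entry `(i, j)` is multiplied by `exp((l j - l i) t / 2)`: it decays, stays constant, or
vanishes by triangularity. -/
theorem tendsto_conjDiag (hT : IsTri l h) :
    Tendsto (conjDiag l h) atTop (𝓝 (blockPart l h)) := by
  refine tendsto_pi_nhds.2 fun i => tendsto_pi_nhds.2 fun j => ?_
  have h1 : (fun t => conjDiag l h t i j) =
      fun t => h i j * Real.exp ((l j - l i) / 2 * t) := by
    funext t
    rw [conjDiag, Matrix.mul_diagonal, Matrix.diagonal_mul, mul_comm (Real.exp _), mul_assoc,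
      ← Real.exp_add]
    ring_nf
  rw [h1, blockPart, Matrix.of_apply]
  rcases lt_trichotomy (l i) (l j) with hij | hij | hij
  · rw [hT i j hij]
    simp [hij.ne]
  · simp [hij]
  · rw [if_neg hij.ne', ← mul_zero (h i j)]
    refine Tendsto.const_mul _ (Real.tendsto_exp_atBot.comp ?_)
    exact tendsto_id.const_mul_atTop_of_neg (by linarith)

theorem det_expDiag_mul (l : ι → ℝ) (t : ℝ) : (expDiag l (-t)).det * (expDiag l t).det = 1 := by
  rw [← Matrix.det_mul, expDiag_mul]
  simp [expDiag]

theorem det_conjDiag (l : ι → ℝ) (h : Matrix ι ι ℝ) (t : ℝ) : (conjDiag l h t).det = h.det := by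
  rw [conjDiag, Matrix.det_mul, Matrix.det_mul, mul_right_comm, det_expDiag_mul, one_mul]

/-- The determinant is constant along the conjugates, hence is inherited by their limit. -/
theorem det_blockPart (hT : IsTri l h) : (blockPart l h).det = h.det := by
  have hc : Continuous fun A : Matrix ι ι ℝ => A.det := continuous_id.matrix_det
  have h1 := (hc.tendsto (blockPart l h)).comp (tendsto_conjDiag hT)
  have h2 : (fun A : Matrix ι ι ℝ => A.det) ∘ conjDiag l h = fun _ => h.det :=
    funext fun t => det_conjDiag l h t
  rw [h2] at h1
  exact tendsto_nhds_unique h1 tendsto_const_nhds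

theorem preserves_blockPart (hT : IsTri l h) (hh : Preserves p h) :
    Preserves p (blockPart l h) := by
  constructor <;> rw [det_blockPart hT]
  exacts [hh.det_ne, hh.det_sq]

theorem expDiag_mul_conjDiag (l : ι → ℝ) (h : Matrix ι ι ℝ) (t : ℝ) :
    expDiag l (t / 2) * conjDiag l h t = h * expDiag l (t / 2) := by
  rw [conjDiag, ← Matrix.mul_assoc, ← Matrix.mul_assoc, expDiag_mul]
  simp [expDiag]

theorem expCurve_eq_congr_conjDiag (l : ι → ℝ) (h : Matrix ι ι ℝ) (t : ℝ) :
    expCurve h l t =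
      expDiag l (t / 2) * (conjDiag l h t * (conjDiag l h t)ᵀ) * (expDiag l (t / 2))ᵀ := by
  rw [expCurve_eq_mul_transpose, ← expDiag_mul_conjDiag, Matrix.transpose_mul]
  simp only [Matrix.mul_assoc]

theorem commute_blockPart (l : ι → ℝ) (h : Matrix ι ι ℝ) (t : ℝ) :
    blockPart l h * expDiag l t = expDiag l t * blockPart l h := by
  ext i j
  rw [Matrix.mul_diagonal, Matrix.diagonal_mul, blockPart, Matrix.of_apply]
  split_ifs with hij
  · rw [hij, mul_comm]
  · simp

/-- Congruence by `exp((t/2) diag l)` acts on such a curve as the shift of its parameter by `t`. -/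
theorem expCurve_commute (hD : ∀ t, D * expDiag l t = expDiag l t * D) (s t : ℝ) :
    expCurve D l (t + s) = expDiag l (t / 2) * expCurve D l s * (expDiag l (t / 2))ᵀ := by
  have := expCurve_affine D l 1 t s
  rw [one_smul, one_mul] at this
  rw [congr_expCurve, ← hD, this, add_comm]

theorem rho_shift (hD : ∀ t, D * expDiag l t = expDiag l t * D) (hp : Preserves p D)
    (hl : p → ∑ i, l i = 0) (s t : ℝ) :
    rho (slice p ι) (expCurve 1 l t) (expCurve D l (t + s)) =
      rho (slice p ι) 1 (expCurve D l s) := by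
  have h1 := expCurve_commute (D := 1) (l := l) (by simp) 0 t
  rw [add_zero, expCurve_zero, Matrix.transpose_one, Matrix.one_mul] at h1
  rw [h1, expCurve_commute hD,
    rho_congr (preserves_diagonal_exp hl _) one_mem_slice (expCurve_mem hp hl s)]

/-- `h γ hᵀ` is asymptotic to `D γ Dᵀ`, with `D` the block diagonal part of `h`. -/
theorem tendsto_rho_blockPart (hT : IsTri l h) (hh : Preserves p h) (hl : p → ∑ i, l i = 0) :
    Tendsto (fun s => rho (slice p ι) (expCurve (blockPart l h) l s) (expCurve h l s)) atTop
      (𝓝 0) := by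
  have hpc : ∀ t, Preserves p (conjDiag l h t) := fun t => by
    constructor <;> rw [det_conjDiag]
    exacts [hh.det_ne, hh.det_sq]
  have hD := mul_transpose_mem_slice (preserves_blockPart hT hh)
  have hc : Continuous fun A : Matrix ι ι ℝ => A * Aᵀ := by fun_prop
  have h1 := tendsto_rho (Eventually.of_forall fun t => mul_transpose_mem_slice (hpc t)) hD
    ((hc.tendsto _).comp (tendsto_conjDiag hT))
  refine h1.congr fun t => ?_
  have h2 := expCurve_commute (commute_blockPart l h) 0 t
  rw [add_zero, expCurve_zero] at h2
  rw [h2, expCurve_eq_congr_conjDiag,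
    rho_congr (preserves_diagonal_exp hl _) hD (mul_transpose_mem_slice (hpc t))]

theorem bddBelow_rho {β : Type*} (S : Set (Matrix ι ι ℝ)) (X : Matrix ι ι ℝ)
    (f : β → Matrix ι ι ℝ) : BddBelow (Set.range fun b => rho S X (f b)) :=
  ⟨0, by rintro _ ⟨b, rfl⟩; exact rho_nonneg _ _ _⟩

theorem rho_expCurve_blockPart_le (hT : IsTri l h) (hh : Preserves p h)
    (hl : p → ∑ i, l i = 0) :
    ∃ C, ∀ᶠ t in atTop, rho (slice p ι) (expCurve 1 l t) (expCurve h l t) ≤ C := by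
  refine ⟨rho (slice p ι) 1 (expCurve (blockPart l h) l 0) + 1, ?_⟩
  have hD := preserves_blockPart hT hh
  filter_upwards [(tendsto_rho_blockPart hT hh hl).eventually_le_const one_pos] with t ht
  have h1 := rho_shift (commute_blockPart l h) hD hl 0 t
  rw [add_zero] at h1
  have := rho_triangle (expCurve_mem (p := p) .one hl t) (expCurve_mem hD hl t)
    (expCurve_mem hh hl t)
  linarith

/-- The point of parameter `s = t` is within `C` of `γ(t)`, whereas those with `s ≤ s₀` recede
linearly in `t`. -/
theorem coDirected_expCurve (hT : IsTri l h) (hh : Preserves p h) (hl : p → ∑ i, l i = 0)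
    (hne : ∃ i, l i ≠ 0) : CoDirected (slice p ι) (expCurve 1 l) (expCurve h l) := by
  intro s₀
  obtain ⟨C, hC⟩ := rho_expCurve_blockPart_le hT hh hl
  obtain ⟨i, hi⟩ := hne
  have hi' := abs_pos.2 hi
  -- Beyond the last bound, points with `s ≤ s₀` are at least `2C` from `h γ(t) hᵀ`, and so no
  -- nearer to `γ(t)` than it is.
  filter_upwards [hC, eventually_ge_atTop s₀, eventually_ge_atTop (s₀ + 2 * C / |l i|)]
    with t ht ht0 ht1
  have : Nonempty (Set.Ici s₀) := ⟨⟨s₀, Set.mem_Ici.2 le_rfl⟩⟩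
  refine le_antisymm (le_ciInf fun s => ciInf_le (bddBelow_rho _ _ _) _) (le_ciInf fun s => ?_)
  rcases le_total s₀ s with hs | hs
  · exact ciInf_le (bddBelow_rho _ _ fun s : Set.Ici s₀ => expCurve h l s) ⟨s, hs⟩
  · refine (ciInf_le (bddBelow_rho _ _ fun s : Set.Ici s₀ => expCurve h l s) ⟨t, ht0⟩).trans ?_
    have h1 := le_rho_expCurve hh hl i t s
    have h2 := rho_triangle (expCurve_mem hh hl t) (expCurve_mem (p := p) .one hl t)
      (expCurve_mem hh hl s)
    rw [rho_comm (expCurve_mem hh hl t) (expCurve_mem (p := p) .one hl t)] at h2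
    have h3 : 2 * C ≤ |l i| * |t - s| := by
      have h4 : 2 * C / |l i| ≤ |t - s| := by linarith [le_abs_self (t - s)]
      rwa [div_le_iff₀ hi', mul_comm (|t - s|)] at h4
    simp only
    linarith

/-- By `rho_shift`, the distance from `γ(t)` to `D γ Dᵀ` is the same for all `t`. Since `h γ hᵀ` is
close to `D γ Dᵀ` only for large parameters, the lower bound uses codirectedness to discard the
small ones. -/
theorem tendsto_distTo_expCurve (hT : IsTri l h) (hh : Preserves p h) (hl : p → ∑ i, l i = 0)
    (hne : ∃ i, l i ≠ 0) :
    Tendsto (fun t => distTo (slice p ι) (expCurve 1 l t) (expCurve h l)) atTop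
      (𝓝 (⨅ s, rho (slice p ι) 1 (expCurve (blockPart l h) l s))) := by
  have hD := preserves_blockPart hT hh
  set D := blockPart l h with hDdef
  have hγ := expCurve_mem (p := p) (ι := ι) .one hl
  have hmD := expCurve_mem hD hl
  have hmh := expCurve_mem hh hl
  set L := ⨅ s, rho (slice p ι) 1 (expCurve D l s) with hL
  have hclose : ∀ ε > 0, ∃ s₀, ∀ s ≥ s₀,
      rho (slice p ι) (expCurve D l s) (expCurve h l s) < ε := fun ε hε =>
    eventually_atTop.1 ((tendsto_rho_blockPart hT hh hl).eventually_lt_const hε)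
  refine tendsto_order.2 ⟨fun r hr => ?_, fun r hr => ?_⟩
  · obtain ⟨s₀, hs₀⟩ := hclose ((L - r) / 2) (by linarith)
    filter_upwards [coDirected_expCurve hT hh hl hne s₀] with t ht
    rw [ht]
    have : Nonempty (Set.Ici s₀) := ⟨⟨s₀, Set.mem_Ici.2 le_rfl⟩⟩
    refine lt_of_lt_of_le (b := L - (L - r) / 2) (by linarith) (le_ciInf fun s => ?_)
    have h1 := rho_triangle (hγ t) (hmh s) (hmD s)
    have h2 := hs₀ s s.2
    rw [rho_comm (hmD _) (hmh _)] at h2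
    have h3 := rho_shift (commute_blockPart l h) hD hl (s - t) t
    rw [add_sub_cancel, ← hDdef] at h3
    have h4 : L ≤ _ := ciInf_le (bddBelow_rho (slice p ι) 1 (expCurve D l)) (s - t)
    linarith
  · obtain ⟨s₀, hs₀⟩ := hclose ((r - L) / 2) (by linarith)
    obtain ⟨s₁, hs₁⟩ := exists_lt_of_ciInf_lt (show L < L + (r - L) / 2 by linarith)
    filter_upwards [eventually_ge_atTop (s₀ - s₁)] with t ht
    refine lt_of_le_of_lt (ciInf_le (bddBelow_rho _ _ _) (t + s₁)) ?_
    have h1 := rho_triangle (hγ t) (hmD (t + s₁)) (hmh (t + s₁))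
    have h2 := hs₀ (t + s₁) (by linarith)
    have h3 := rho_shift (commute_blockPart l h) hD hl s₁ t
    rw [← hDdef] at h3
    linarith

section affine

variable {S : Set (Matrix ι ι ℝ)} {μ ν : ℝ → Matrix ι ι ℝ} {a b : ℝ}

theorem distTo_affine (ha : 0 < a) (X : Matrix ι ι ℝ) :
    distTo S X (fun t => ν (a * t + b)) = distTo S X ν := by
  have hs : Function.Surjective fun t : ℝ => a * t + b := fun y =>
    ⟨(y - b) / a, by field_simp; ring⟩
  exact hs.iInf_comp fun s => rho S X (ν s)

theorem CoDirected.affine (ha : 0 < a) (h : CoDirected S μ ν) :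
    CoDirected S μ fun t => ν (a * t + b) := by
  intro s₀
  filter_upwards [h (a * s₀ + b)] with t ht
  rw [distTo_affine ha, ht]
  let f : Set.Ici s₀ → Set.Ici (a * s₀ + b) := fun s =>
    ⟨a * s + b, by have := mul_le_mul_of_nonneg_left s.2.out ha.le; simpa using this⟩
  have hf : Function.Surjective f := fun y => by
    refine ⟨⟨(y - b) / a, ?_⟩, ?_⟩
    · have := y.2.out
      rw [Set.mem_Ici, le_div_iff₀ ha]
      linarith
    · ext
      simp only [f]
      field_simp
      ring
  exact (hf.iInf_comp fun s => rho S (μ t) (ν s)).symm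

end affine

/-- The curves `h γ hᵀ` with `h` block triangular belong to the finite pencil of `γ`. -/
theorem mem_finitePencil_of_isTri {ν : ℝ → Matrix ι ι ℝ} (hT : IsTri l h) (hh : Preserves p h)
    (hl : p → ∑ i, l i = 0) (hne : ∃ i, l i ≠ 0) (hν : SameDirected ν (expCurve h l)) :
    ν ∈ finitePencil (slice p ι) (expCurve 1 l) ∧
      Tendsto (fun t => distTo (slice p ι) (expCurve 1 l t) ν) atTop
        (𝓝 (⨅ s, rho (slice p ι) 1 (expCurve (blockPart l h) l s))) := by
  obtain ⟨a, b, ha, hab⟩ := hν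
  obtain rfl : ν = fun t => expCurve h l (a * t + b) := funext hab
  have hlim := tendsto_distTo_expCurve hT hh hl hne
  rw [← funext fun t => distTo_affine (b := b) ha (expCurve 1 l t)] at hlim
  refine ⟨⟨?_, (coDirected_expCurve hT hh hl hne).affine ha, _, hlim⟩, hlim⟩
  refine isGeodesic_iff.2 ⟨h * expDiag l (b / 2), a • l, hh.mul (preserves_diagonal_exp hl _),
    fun hp => ?_, ?_, funext fun t => (expCurve_affine h l a b t).symm⟩
  · simp [← Finset.mul_sum, hl hp]
  · obtain ⟨i, hi⟩ := hne
    exact ⟨i, mul_ne_zero ha.ne' hi⟩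

theorem mem_nullPencil_of_isTri {ν : ℝ → Matrix ι ι ℝ} (hT : IsTri l h) (hh : Preserves p h)
    (h1 : blockPart l h = 1) (hl : p → ∑ i, l i = 0) (hne : ∃ i, l i ≠ 0)
    (hν : SameDirected ν (expCurve h l)) :
    ν ∈ nullPencil (slice p ι) (expCurve 1 l) := by
  obtain ⟨⟨hg, hc, -⟩, hlim⟩ := mem_finitePencil_of_isTri hT hh hl hne hν
  refine ⟨hg, hc, ?_⟩
  have h0 : ⨅ s, rho (slice p ι) 1 (expCurve (blockPart l h) l s) = 0 := by
    refine le_antisymm ?_ (le_ciInf fun s => rho_nonneg _ _ _)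
    refine (ciInf_le (bddBelow_rho _ _ _) 0).trans_eq ?_
    rw [h1, expCurve_zero, Matrix.transpose_one, Matrix.one_mul, rho_self one_mem_slice]
  rwa [h0] at hlim

end

/-! ### The converse: members of the pencils come from triangular matrices. -/

section

variable {ι : Type*} [Fintype ι] [DecidableEq ι]

variable {p : Prop} {X Y : Matrix ι ι ℝ} {h D k : Matrix ι ι ℝ} {l m : ι → ℝ}

/-- A nonzero sum of exponentials with nonnegative coefficients grows as its fastest term. -/
theorem exists_log_growth {w : ι → ℝ} (hw : w ≠ 0) (m : ι → ℝ) :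
    ∃ a M : ℝ, ∀ s, 0 ≤ s → |Real.log (∑ i, w i ^ 2 * Real.exp (m i * s)) - a * s| ≤ M := by
  obtain ⟨i₀, hi₀⟩ := Function.ne_iff.1 hw
  have hne : (Finset.univ.filter fun i => w i ≠ 0).Nonempty := ⟨i₀, by simpa using hi₀⟩
  obtain ⟨i, hi, hmax⟩ := Finset.exists_max_image _ m hne
  have hi' : w i ≠ 0 := by simpa using hi
  have hwi : 0 < w i ^ 2 := by positivity
  refine ⟨m i, |Real.log (w i ^ 2)| + |Real.log (∑ j, w j ^ 2)|, fun s hs => ?_⟩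
  have hlow : w i ^ 2 * Real.exp (m i * s) ≤ ∑ j, w j ^ 2 * Real.exp (m j * s) :=
    Finset.single_le_sum (f := fun j => w j ^ 2 * Real.exp (m j * s))
      (fun j _ => by positivity) (Finset.mem_univ i)
  have hup : ∑ j, w j ^ 2 * Real.exp (m j * s) ≤ (∑ j, w j ^ 2) * Real.exp (m i * s) := by
    rw [Finset.sum_mul]
    refine Finset.sum_le_sum fun j _ => ?_
    by_cases hj : w j = 0
    · simp [hj]
    · have := hmax j (by simpa using hj)
      gcongr
  have hE := Real.exp_pos (m i * s)
  have hW : 0 < ∑ j, w j ^ 2 := by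
    have : w i ^ 2 ≤ ∑ j, w j ^ 2 :=
      Finset.single_le_sum (f := fun j => w j ^ 2) (fun j _ => sq_nonneg _) (Finset.mem_univ i)
    linarith
  have h1 := Real.log_le_log (by positivity) hlow
  have h2 := Real.log_le_log (lt_of_lt_of_le (by positivity) hlow) hup
  rw [Real.log_mul hwi.ne' hE.ne', Real.log_exp] at h1
  rw [Real.log_mul hW.ne' hE.ne', Real.log_exp] at h2
  refine abs_le.2 ⟨?_, ?_⟩
  · linarith [neg_abs_le (Real.log (w i ^ 2)), abs_nonneg (Real.log (∑ j, w j ^ 2))]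
  · linarith [le_abs_self (Real.log (∑ j, w j ^ 2)), abs_nonneg (Real.log (w i ^ 2))]

theorem transpose_mulVec_ne_zero (hk : IsUnit k.det) {v : ι → ℝ} (hv : v ≠ 0) :
    kᵀ *ᵥ v ≠ 0 := by
  intro h0
  refine hv ?_
  have : k⁻¹ᵀ *ᵥ (kᵀ *ᵥ v) = v := by
    rw [Matrix.mulVec_mulVec, inv_transpose_mul_transpose hk, Matrix.one_mulVec]
  rw [← this, h0, Matrix.mulVec_zero]

/-- If `γ(t)` stays at a bounded distance from points running to the positive end of a geodesic,
then it does so for an affine correspondence of the parameters. -/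
theorem exists_affine_of_bounded (hk : Preserves p k) (hm : p → ∑ i, m i = 0)
    (hl : p → ∑ i, l i = 0) (hne : ∃ i, l i ≠ 0) {C : ℝ}
    (hC : ∀ s₀, ∀ᶠ t in atTop, ∃ s ≥ s₀,
      rho (slice p ι) (expCurve 1 l t) (expCurve k m s) ≤ C) :
    ∃ a > 0, ∃ C', ∀ᶠ t in atTop,
      rho (slice p ι) (expCurve 1 l t) (expCurve k m (a * t)) ≤ C' := by
  obtain ⟨i, hi⟩ := hne
  have hγ := expCurve_mem (p := p) (ι := ι) .one hl
  have hν := expCurve_mem hk hm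
  obtain ⟨b, M, hM⟩ := exists_log_growth
    (transpose_mulVec_ne_zero hk.isUnit (single_one_ne_zero i)) m
  have hlin : ∀ t s, 0 ≤ s → rho (slice p ι) (expCurve 1 l t) (expCurve k m s) ≤ C →
      |l i * t - b * s| ≤ C + M := by
    intro t s hs h1
    have h2 := abs_log_sub_log_le_rho (hγ t) (hν s) (single_one_ne_zero i)
    rw [log_dotProduct_expCurve_one, dotProduct_expCurve] at h2
    have h3 := abs_sub_le (l i * t) (Real.log (∑ j, (kᵀ *ᵥ Pi.single i 1) j ^ 2 *
      Real.exp (m j * s))) (b * s)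
    linarith [hM s hs]
  have hi' := abs_pos.2 hi
  -- Were the rate zero, `l i * t` would stay bounded as `t → ∞`.
  have hb : b ≠ 0 := by
    rintro rfl
    obtain ⟨t, ⟨s, hs, h1⟩, ht⟩ := ((hC 0).and (eventually_gt_atTop ((C + M) / |l i|))).exists
    have h2 := hlin t s hs h1
    rw [zero_mul, sub_zero, abs_mul] at h2
    rw [div_lt_iff₀ hi'] at ht
    nlinarith [le_abs_self t]
  have hb' := abs_pos.2 hb
  set a := l i / b with ha
  set K := (C + M) / |b| with hK
  have hlin' : ∀ t s, 0 ≤ s → rho (slice p ι) (expCurve 1 l t) (expCurve k m s) ≤ C →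
      |a * t - s| ≤ K := by
    intro t s hs h1
    rw [hK, le_div_iff₀ hb', ← abs_mul]
    have : (a * t - s) * b = l i * t - b * s := by rw [ha]; field_simp
    rw [this]
    exact hlin t s hs h1
  -- The direction enters here: `s` can be taken at least `K + 1`, while `a * t` is within `K` of
  -- `s`.
  have hapos : 0 < a := by
    obtain ⟨t, ⟨s, hs, h1⟩, ht⟩ := ((hC (max 0 (K + 1))).and (eventually_gt_atTop 0)).exists
    have h2 := hlin' t s ((le_max_left _ _).trans hs) h1
    have h3 := (le_max_right 0 (K + 1)).trans hs
    have h4 : 0 < a * t := by linarith [(abs_le.1 h2).1]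
    exact pos_of_mul_pos_left h4 ht.le
  refine ⟨a, hapos, C + √(∑ i, m i ^ 2) * K, ?_⟩
  filter_upwards [hC 0] with t ⟨s, hs, h1⟩
  have h2 := rho_triangle (hγ t) (hν s) (hν (a * t))
  have h3 := rho_expCurve_expCurve_le hk hm s (a * t)
  have h4 := mul_le_mul_of_nonneg_left (hlin' t s hs h1) (Real.sqrt_nonneg (∑ i, m i ^ 2))
  linarith

/-- At the `i`-th basis vector the second form contains the term `k i j ^ 2 * exp(m j * t)`, whose
logarithm may exceed `l i * t` by at most `C`. -/
theorem le_of_rho_bounded (hk : Preserves p k) (hm : p → ∑ i, m i = 0) (hl : p → ∑ i, l i = 0)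
    {C : ℝ} (hC : ∀ᶠ t in atTop, rho (slice p ι) (expCurve 1 l t) (expCurve k m t) ≤ C)
    {i j : ι} (hij : k i j ≠ 0) : m j ≤ l i := by
  by_contra! hlt
  have hpos : 0 < k i j ^ 2 := by positivity
  obtain ⟨t, ht, ht2⟩ := (hC.and
    (eventually_gt_atTop ((C - Real.log (k i j ^ 2)) / (m j - l i)))).exists
  have h2 := abs_log_sub_log_le_rho (expCurve_mem (p := p) .one hl t) (expCurve_mem hk hm t)
    (single_one_ne_zero i)
  rw [log_dotProduct_expCurve_one, dotProduct_expCurve] at h2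
  have h3 : k i j ^ 2 * Real.exp (m j * t) ≤
      ∑ x, (kᵀ *ᵥ Pi.single i 1) x ^ 2 * Real.exp (m x * t) := by
    rw [← transpose_mulVec_single k i j]
    exact Finset.single_le_sum
      (f := fun x => (kᵀ *ᵥ Pi.single i 1) x ^ 2 * Real.exp (m x * t))
      (fun x _ => by positivity) (Finset.mem_univ j)
  have h4 := Real.log_le_log (by positivity) h3
  rw [Real.log_mul hpos.ne' (Real.exp_pos _).ne', Real.log_exp] at h4
  rw [div_lt_iff₀ (by linarith)] at ht2
  linarith [(abs_le.1 h2).1]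

/-- Some term of the Leibniz expansion is nonzero. -/
theorem exists_perm_ne_zero (hk : k.det ≠ 0) : ∃ σ : Equiv.Perm ι, ∀ i, k (σ i) i ≠ 0 := by
  rw [Matrix.det_apply] at hk
  obtain ⟨σ, -, hσ⟩ := Finset.exists_ne_zero_of_sum_ne_zero hk
  refine ⟨σ, fun i h0 => hσ ?_⟩
  have : ∏ j, k (σ j) j = 0 := Finset.prod_eq_zero (Finset.mem_univ i) h0
  simp [this]

/-- A geodesic asymptotic to `γ`, with the same speed of its parameter, is of the form `h γ hᵀ`. -/
theorem exists_isTri_of_rho_bounded (hk : Preserves p k) (hm : p → ∑ i, m i = 0)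
    (hl : p → ∑ i, l i = 0) {C : ℝ}
    (hC : ∀ᶠ t in atTop, rho (slice p ι) (expCurve 1 l t) (expCurve k m t) ≤ C) :
    ∃ h, Preserves p h ∧ IsTri l h ∧ expCurve k m = expCurve h l := by
  -- Applying the isometry `k⁻¹` exchanges the roles of `l` and `m`.
  have hC' : ∀ᶠ t in atTop, rho (slice p ι) (expCurve 1 m t) (expCurve k⁻¹ l t) ≤ C := by
    filter_upwards [hC] with t ht
    have h1 := rho_congr hk.inv (expCurve_mem (p := p) .one hl t) (expCurve_mem hk hm t)
    rw [congr_expCurve, congr_expCurve, Matrix.mul_one, Matrix.nonsing_inv_mul _ hk.isUnit] at h1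
    rwa [rho_comm (expCurve_mem .one hm t) (expCurve_mem hk.inv hl t), h1]
  have hle : ∀ i j, k i j ≠ 0 → m j ≤ l i := fun i j => le_of_rho_bounded hk hm hl hC
  obtain ⟨σ, hσ⟩ := exists_perm_ne_zero hk.det_ne
  obtain ⟨τ, hτ⟩ := exists_perm_ne_zero hk.inv.det_ne
  have h1 : ∀ j ∈ Finset.univ, m j ≤ l (σ j) := fun j _ => hle _ _ (hσ j)
  have h2 : ∀ j ∈ Finset.univ, l j ≤ m (τ j) := fun j _ =>
    le_of_rho_bounded hk.inv hl hm hC' (hτ j)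
  -- The two families of inequalities give equal sums, so each inequality `m j ≤ l (σ j)` is an
  -- equality.
  have h3 : ∑ j, m j = ∑ j, l (σ j) := by
    refine le_antisymm (Finset.sum_le_sum h1) ?_
    rw [Equiv.sum_comp σ l, ← Equiv.sum_comp τ m]
    exact Finset.sum_le_sum h2
  have heq : ∀ j, m j = l (σ j) := fun j =>
    (Finset.sum_eq_sum_iff_of_le h1).1 h3 j (Finset.mem_univ j)
  have hcurve : expCurve k m = expCurve (k.submatrix id σ.symm) l := by
    funext t
    ext i j
    simp only [expCurve, diagonal_congr_apply, Matrix.submatrix_apply, id]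
    rw [← Equiv.sum_comp σ fun x => k i (σ.symm x) * Real.exp (l x * t) * k j (σ.symm x)]
    simp [heq]
  refine ⟨k.submatrix id σ.symm, ?_, fun i j hij => ?_, hcurve⟩
  · refine preserves_of_mul_transpose (X := expCurve k m 0) (expCurve_mem hk hm 0) ?_
    rw [hcurve, expCurve_zero]
  · by_contra h0
    have := hle i (σ.symm j) h0
    rw [heq, Equiv.apply_symm_apply] at this
    linarith

theorem exists_isTri_of_mem_finitePencil {ν : ℝ → Matrix ι ι ℝ} (hl : p → ∑ i, l i = 0)
    (hne : ∃ i, l i ≠ 0) (hν : ν ∈ finitePencil (slice p ι) (expCurve 1 l)) :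
    ∃ h, Preserves p h ∧ IsTri l h ∧ SameDirected ν (expCurve h l) := by
  obtain ⟨hg, hc, L, hL⟩ := hν
  obtain ⟨k, m, hk, hm, -, rfl⟩ := isGeodesic_iff.1 hg
  obtain ⟨a, ha, C, hC⟩ := exists_affine_of_bounded (C := L + 1) hk hm hl hne fun s₀ => by
    filter_upwards [hc s₀, hL.eventually_lt_const (lt_add_one L)] with t ht1 ht2
    rw [ht1] at ht2
    have : Nonempty (Set.Ici s₀) := ⟨⟨s₀, Set.mem_Ici.2 le_rfl⟩⟩
    obtain ⟨s, hs⟩ := exists_lt_of_ciInf_lt ht2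
    exact ⟨s, s.2, hs.le⟩
  have haff : ∀ t, expCurve k m (a * t) = expCurve k (a • m) t := fun t => by
    have := expCurve_affine k m a 0 t
    rw [add_zero] at this
    rw [← this]
    simp [expDiag]
  simp only [haff] at hC
  obtain ⟨h, hh, hT, heq⟩ := exists_isTri_of_rho_bounded hk
    (fun hp => by simp [← Finset.mul_sum, hm hp]) hl hC
  refine ⟨h, hh, hT, a⁻¹, 0, inv_pos.2 ha, fun t => ?_⟩
  rw [← heq, ← haff, add_zero, mul_inv_cancel_left₀ ha.ne']

theorem finitePencil_eq (hl : p → ∑ i, l i = 0) (hne : ∃ i, l i ≠ 0) :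
    finitePencil (slice p ι) (expCurve 1 l) =
      {ν | ∃ h, Preserves p h ∧ IsTri l h ∧ SameDirected ν (expCurve h l)} := by
  ext ν
  exact ⟨exists_isTri_of_mem_finitePencil hl hne, fun ⟨h, hh, hT, hν⟩ =>
    (mem_finitePencil_of_isTri hT hh hl hne hν).1⟩

/-- Because `D` commutes with the flow, the logarithm of the form at a basis vector is exactly
affine in `s`. Near-minimizers of the distance to `1` must therefore approach its zero `s₀`, so the
infimum is attained there. -/
theorem exists_expCurve_eq_one (hD : ∀ t, D * expDiag l t = expDiag l t * D) (hp : Preserves p D)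
    (hl : p → ∑ i, l i = 0) (hne : ∃ i, l i ≠ 0)
    (h0 : ⨅ s, rho (slice p ι) 1 (expCurve D l s) = 0) : ∃ s, expCurve D l s = 1 := by
  obtain ⟨i, hi⟩ := hne
  have hi' := abs_pos.2 hi
  have hmem := expCurve_mem hp hl
  set q := (Pi.single i 1 : ι → ℝ) ⬝ᵥ (D * Dᵀ) *ᵥ Pi.single i 1 with hq
  have hqpos : 0 < q := dotProduct_pos (mul_transpose_mem_slice hp).1 (single_one_ne_zero i)
  have hform : ∀ s, Real.log ((Pi.single i 1 : ι → ℝ) ⬝ᵥ expCurve D l s *ᵥ Pi.single i 1) =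
      l i * s + Real.log q := by
    intro s
    have h1 := expCurve_commute hD 0 s
    rw [add_zero, expCurve_zero] at h1
    have h2 : (Pi.single i 1 : ι → ℝ) ⬝ᵥ expCurve D l s *ᵥ Pi.single i 1 =
        Real.exp (l i * s) * q := by
      rw [h1, hq]
      simp only [Matrix.diagonal_transpose, Matrix.mulVec_single_one, single_one_dotProduct,
        Matrix.col_apply, Matrix.mul_diagonal, Matrix.diagonal_mul]
      rw [mul_right_comm, ← Real.exp_add]
      ring_nf
    rw [h2, Real.log_mul (Real.exp_pos _).ne' hqpos.ne', Real.log_exp]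
  set s₀ := -Real.log q / l i with hs₀
  have hs : ∀ s, |l i| * |s - s₀| ≤ rho (slice p ι) 1 (expCurve D l s) := by
    intro s
    have := abs_log_sub_log_le_rho one_mem_slice (hmem s) (single_one_ne_zero i)
    rw [hform] at this
    rw [← abs_mul]
    refine le_trans (le_of_eq ?_) this
    have h1 : l i * s₀ = -Real.log q := by rw [hs₀, mul_div_cancel₀ _ hi]
    rw [abs_sub_comm, mul_sub, h1]
    simp
  refine ⟨s₀, (eq_of_rho_eq_zero one_mem_slice (hmem s₀) ?_).symm⟩
  refine le_antisymm (le_of_forall_pos_le_add fun ε hε => ?_) (rho_nonneg _ _ _)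
  set A := √(∑ i, l i ^ 2)
  have hA : 0 ≤ A := Real.sqrt_nonneg _
  -- Chosen so that `δ + A * (δ / |l i|) = ε`, where `A` is the speed of the curve.
  set δ := ε / (1 + A / |l i|) with hδ
  have hden : 0 < 1 + A / |l i| := by positivity
  obtain ⟨s, hsδ⟩ := exists_lt_of_ciInf_lt
    (show ⨅ s, rho (slice p ι) 1 (expCurve D l s) < δ by rw [h0]; positivity)
  have h1 := rho_triangle one_mem_slice (hmem s) (hmem s₀)
  have h2 := rho_expCurve_expCurve_le hp hl s s₀
  have h3 : |s₀ - s| ≤ δ / |l i| := by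
    rw [le_div_iff₀ hi', abs_sub_comm, mul_comm]
    exact (hs s).trans hsδ.le
  have h4 : A * |s₀ - s| ≤ A * (δ / |l i|) := by gcongr
  have h5 : δ + A * (δ / |l i|) = ε := by
    rw [hδ]
    field_simp
  linarith

/-- A block triangular matrix is the product of a block unipotent and a block diagonal one. -/
theorem isTri_mul_inv_blockPart (hT : IsTri l h) (hu : IsUnit h.det) :
    IsTri l (h * (blockPart l h)⁻¹) ∧ blockPart l (h * (blockPart l h)⁻¹) = 1 := by
  set D := blockPart l h with hD
  have hDu : IsUnit D.det := by rwa [hD, det_blockPart hT]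
  -- The inverse of `D` also commutes with `expDiag l 1`, whose diagonal entries separate the values
  -- of `l`; hence it is block diagonal.
  have hinv : ∀ i j, l i ≠ l j → D⁻¹ i j = 0 := by
    intro i j hij
    have hc : D⁻¹ * expDiag l 1 = expDiag l 1 * D⁻¹ := by
      calc D⁻¹ * expDiag l 1 = D⁻¹ * expDiag l 1 * (D * D⁻¹) := by
            rw [Matrix.mul_nonsing_inv _ hDu, Matrix.mul_one]
        _ = D⁻¹ * (expDiag l 1 * D) * D⁻¹ := by simp only [Matrix.mul_assoc]
        _ = (D⁻¹ * D) * expDiag l 1 * D⁻¹ := by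
            rw [← commute_blockPart l h 1]; simp only [Matrix.mul_assoc, hD]
        _ = _ := by rw [Matrix.nonsing_inv_mul _ hDu, Matrix.one_mul]
    have h1 := congrFun (congrFun hc i) j
    rw [Matrix.mul_diagonal, Matrix.diagonal_mul, mul_comm, mul_one, mul_one,
      ← sub_eq_zero, ← sub_mul, mul_eq_zero, sub_eq_zero, Real.exp_eq_exp] at h1
    exact h1.resolve_left (Ne.symm hij)
  constructor
  · intro i j hij
    rw [Matrix.mul_apply]
    refine Finset.sum_eq_zero fun x _ => ?_
    by_cases hx : l x = l j
    · rw [hT i x (by rwa [hx]), zero_mul]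
    · rw [hinv x j hx, mul_zero]
  · ext i j
    rw [blockPart, Matrix.of_apply]
    split_ifs with hij
    · rw [← Matrix.mul_nonsing_inv _ hDu, Matrix.mul_apply, Matrix.mul_apply]
      refine Finset.sum_congr rfl fun x _ => ?_
      by_cases hx : l x = l j
      · rw [hD, blockPart, Matrix.of_apply, if_pos (hij.trans hx.symm)]
      · rw [hinv x j hx, mul_zero, mul_zero]
    · rw [Matrix.one_apply_ne]
      rintro rfl
      exact hij rfl

theorem exists_uni_of_mem_nullPencil {ν : ℝ → Matrix ι ι ℝ} (hl : p → ∑ i, l i = 0)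
    (hne : ∃ i, l i ≠ 0) (hν : ν ∈ nullPencil (slice p ι) (expCurve 1 l)) :
    ∃ h, IsTri l h ∧ blockPart l h = 1 ∧ SameDirected ν (expCurve h l) := by
  obtain ⟨hg, hc, h0⟩ := hν
  obtain ⟨h, hh, hT, hν⟩ := exists_isTri_of_mem_finitePencil hl hne ⟨hg, hc, 0, h0⟩
  have hlim := (mem_finitePencil_of_isTri hT hh hl hne hν).2
  have hD := preserves_blockPart hT hh
  have hcomm := commute_blockPart l h
  obtain ⟨s, hs⟩ := exists_expCurve_eq_one hcomm hD hl hne (tendsto_nhds_unique hlim h0)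
  obtain ⟨hT', hU⟩ := isTri_mul_inv_blockPart hT hh.isUnit
  refine ⟨_, hT', hU, ?_⟩
  -- `D γ Dᵀ` passes through `1` at `s`, so it is `γ` delayed by `s`; congruence by `h D⁻¹` turns it
  -- into `h γ hᵀ`.
  have hcurve : ∀ t, expCurve h l t = expCurve (h * (blockPart l h)⁻¹) l (t + -s) := by
    intro t
    have h1 : expCurve (blockPart l h) l t = expCurve 1 l (t + -s) := by
      have e1 := expCurve_commute hcomm s (t + -s)
      have e2 := expCurve_commute (D := 1) (l := l) (by simp) 0 (t + -s)
      rw [add_zero, expCurve_zero, Matrix.transpose_one, Matrix.one_mul] at e2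
      rw [e2, ← hs, ← e1, neg_add_cancel_right]
    have h2 : h * (blockPart l h)⁻¹ * blockPart l h = h := by
      rw [Matrix.mul_assoc, Matrix.nonsing_inv_mul _ hD.isUnit, Matrix.mul_one]
    rw [← h2, ← congr_expCurve, h2, h1, congr_expCurve, Matrix.mul_one]
  obtain ⟨a, b, ha, hab⟩ := hν
  refine ⟨a, b + -s, ha, fun t => ?_⟩
  rw [hab, hcurve, add_assoc]

theorem preserves_of_blockPart_eq_one (hT : IsTri l h) (h1 : blockPart l h = 1) :
    Preserves p h := by
  constructor <;> rw [← det_blockPart hT, h1] <;> simp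

theorem nullPencil_eq (hl : p → ∑ i, l i = 0) (hne : ∃ i, l i ≠ 0) :
    nullPencil (slice p ι) (expCurve 1 l) =
      {ν | ∃ h, IsTri l h ∧ blockPart l h = 1 ∧ SameDirected ν (expCurve h l)} := by
  ext ν
  exact ⟨exists_uni_of_mem_nullPencil hl hne, fun ⟨h, hT, h1, hν⟩ =>
    mem_nullPencil_of_isTri hT (preserves_of_blockPart_eq_one hT h1) h1 hl hne hν⟩

end

/-! ### Block matrices, scalar factors and the theorem itself. -/

section

section

variable {n : ℕ} {α : Fin n → ℕ} {ψ : Fin n → ℝ}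

theorem mul_gam_mul_eq (h : Matrix (Idx α) (Idx α) ℝ) (t : ℝ) :
    h * gam α ψ t * hᵀ = expCurve h (fun i => ψ i.1) t := rfl

theorem gam_eq_expCurve : gam α ψ = expCurve 1 (fun i => ψ i.1) :=
  funext fun t => (expCurve_one_left _ t).symm

theorem mem_blockTri_iff (hψ : StrictAnti ψ) {h : Matrix (Idx α) (Idx α) ℝ} :
    h ∈ blockTri α ↔ IsUnit h.det ∧ IsTri (fun i => ψ i.1) h := by
  simp only [blockTri, Set.mem_ofPred_eq, IsTri, hψ.lt_iff_gt]

theorem mem_blockUni_iff (hψ : StrictAnti ψ) {h : Matrix (Idx α) (Idx α) ℝ} :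
    h ∈ blockUni α ↔
      IsTri (fun i => ψ i.1) h ∧ blockPart (fun i : Idx α => ψ i.1) h = 1 := by
  simp only [blockUni, Set.mem_ofPred_eq, IsTri, hψ.lt_iff_gt]
  refine and_congr_right fun _ => ⟨fun hd => ?_, fun hd k => ?_⟩
  · ext ⟨k, i⟩ ⟨k', j⟩
    rw [blockPart, Matrix.of_apply]
    by_cases hk : k = k'
    · subst hk
      have := congrFun (congrFun (hd k) i) j
      rw [Matrix.blockDiag'_apply] at this
      rw [if_pos rfl, this]
      simp [Matrix.one_apply]
    · rw [if_neg (hψ.injective.ne hk), Matrix.one_apply_ne (by simp [hk])]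
  · ext i j
    have := congrFun (congrFun hd ⟨k, i⟩) ⟨k, j⟩
    rw [blockPart, Matrix.of_apply, if_pos rfl] at this
    rw [Matrix.blockDiag'_apply, this]
    simp [Matrix.one_apply]

end

variable {ι : Type*} [Fintype ι] [DecidableEq ι]

theorem toPEE_smul [Nonempty ι] {X : Matrix ι ι ℝ} (hX : X.det = 1) {a : ℝ} (ha : 0 < a) :
    toPEE (a • X) = X := by
  have hn : (Fintype.card ι : ℝ) ≠ 0 := by exact_mod_cast Fintype.card_ne_zero
  rw [toPEE, Matrix.det_smul, hX, mul_one, smul_smul, ← Real.rpow_natCast,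
    ← Real.rpow_mul ha.le, mul_neg, mul_one_div_cancel hn, Real.rpow_neg_one,
    inv_mul_cancel₀ ha.ne', one_smul]

/-- A common shift of the exponents is a scalar factor, invisible in `ℙ𝔼`. -/
theorem expCurve_add_const (h : Matrix ι ι ℝ) (l : ι → ℝ) (c t : ℝ) :
    expCurve h (fun i => l i + c) t = Real.exp (c * t) • expCurve h l t := by
  have : Matrix.diagonal (fun i => Real.exp ((l i + c) * t)) =
      Real.exp (c * t) • Matrix.diagonal fun i => Real.exp (l i * t) := by
    rw [← Matrix.diagonal_smul]
    congr 1
    funext i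
    rw [Pi.smul_apply, smul_eq_mul, ← Real.exp_add]
    ring_nf
  rw [expCurve, this, Matrix.mul_smul, Matrix.smul_mul, expCurve]

theorem toPEE_expCurve [Nonempty ι] {h : Matrix ι ι ℝ} {l : ι → ℝ} (hl : ∑ i, l i = 0)
    {r : ℝ} (hr : r ≠ 0) (hh : Preserves True (r • h)) (c t : ℝ) :
    toPEE (expCurve h (fun i => l i + c) t) = expCurve (r • h) l t := by
  have h1 : expCurve h (fun i => l i + c) t =
      (Real.exp (c * t) * (r ^ 2)⁻¹) • expCurve (r • h) l t := by
    rw [expCurve_add_const, expCurve, expCurve, Matrix.transpose_smul, Matrix.mul_smul,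
      Matrix.smul_mul, Matrix.smul_mul, smul_smul, smul_smul]
    congr 1
    field_simp
  rw [h1, toPEE_smul ((expCurve_mem hh (fun _ => hl) t).2 trivial) (by positivity)]

/-- The scale is `|det h| ^ (-1/n)`. It makes the determinant `±1`, which suffices since `h X hᵀ`
involves only its square. -/
theorem exists_smul_preserves [Nonempty ι] {h : Matrix ι ι ℝ} (hh : IsUnit h.det) :
    ∃ r : ℝ, r ≠ 0 ∧ Preserves True (r • h) := by
  have hn : (Fintype.card ι : ℝ) ≠ 0 := by exact_mod_cast Fintype.card_ne_zero
  have hd : 0 < |h.det| := abs_pos.2 hh.ne_zero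
  set r := |h.det| ^ (-(1 / (Fintype.card ι : ℝ))) with hr
  have hrpos : 0 < r := Real.rpow_pos_of_pos hd _
  have hrn : r ^ Fintype.card ι = |h.det|⁻¹ := by
    rw [hr, ← Real.rpow_natCast, ← Real.rpow_mul hd.le, neg_mul, one_div_mul_cancel hn,
      Real.rpow_neg_one]
  have hsq : (r • h).det ^ 2 = 1 := by
    rw [Matrix.det_smul, hrn, mul_pow, inv_pow, sq_abs,
      inv_mul_cancel₀ (pow_ne_zero 2 hh.ne_zero)]
  exact ⟨r, hrpos.ne', fun h0 => by simp [h0] at hsq, fun _ => hsq⟩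

end

end SymPencil

theorem theorem3p3 {m : ℕ} (α : Fin m → ℕ) (hα : ∀ k, 0 < α k)
    (ψ : Fin m → ℝ) (hψ : StrictAnti ψ) :
    -- the pencils in `𝔼`, when `γ` is not constant there
    ((∃ k, ψ k ≠ 0) →
      finitePencil (EE (Idx α)) (gam α ψ) =
          {ν | ∃ h ∈ blockTri α, SameDirected ν fun t => h * gam α ψ t * hᵀ} ∧
        nullPencil (EE (Idx α)) (gam α ψ) =
          {ν | ∃ h ∈ blockUni α, SameDirected ν fun t => h * gam α ψ t * hᵀ}) ∧
    -- the pencils in `ℙ𝔼`, when `γ` is not constant there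
    (1 < m →
      finitePencil (PEE (Idx α)) (fun t => toPEE (gam α ψ t)) =
          {ν | ∃ h ∈ blockTri α, SameDirected ν fun t => toPEE (h * gam α ψ t * hᵀ)} ∧
        nullPencil (PEE (Idx α)) (fun t => toPEE (gam α ψ t)) =
          {ν | ∃ h ∈ blockUni α, SameDirected ν fun t => toPEE (h * gam α ψ t * hᵀ)}) := by
  constructor
  · rintro ⟨k, hk⟩
    have hne : ∃ i : Idx α, ψ i.1 ≠ 0 := ⟨⟨k, ⟨0, hα k⟩⟩, hk⟩
    have hl : False → ∑ i : Idx α, ψ i.1 = 0 := False.elim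
    rw [EE_eq_slice, gam_eq_expCurve, finitePencil_eq hl hne, nullPencil_eq hl hne]
    simp only [← gam_eq_expCurve, mul_gam_mul_eq]
    constructor
    · ext ν
      refine exists_congr fun h => ?_
      rw [mem_blockTri_iff hψ, ← and_assoc]
      exact and_congr_left fun _ => and_congr_left fun _ =>
        ⟨fun hh => hh.isUnit, fun hh => ⟨hh.ne_zero, False.elim⟩⟩
    · ext ν
      refine exists_congr fun h => ?_
      rw [mem_blockUni_iff hψ, and_assoc]
  · intro hm
    have hne0 : Nonempty (Idx α) := ⟨⟨⟨0, by omega⟩, ⟨0, hα _⟩⟩⟩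
    -- Subtracting the mean makes the exponents sum to zero, as tangency to determinant 1 requires.
    set c : ℝ := (∑ i : Idx α, ψ i.1) / Fintype.card (Idx α) with hc
    set φ : Fin m → ℝ := fun k => ψ k - c with hφdef
    have hφ : StrictAnti φ := fun i j hij => sub_lt_sub_right (hψ hij) c
    have hn : (Fintype.card (Idx α) : ℝ) ≠ 0 := by exact_mod_cast Fintype.card_ne_zero
    have hl : ∑ i : Idx α, φ i.1 = 0 := by
      simp only [hφdef, Finset.sum_sub_distrib, Finset.sum_const, Finset.card_univ, nsmul_eq_mul]
      rw [hc, mul_div_cancel₀ _ hn, sub_self]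
    -- With at least two blocks, distinct exponents cannot both be zero.
    have hne : ∃ i : Idx α, φ i.1 ≠ 0 := by
      by_contra! h0
      have h1 : φ ⟨0, by omega⟩ = 0 := h0 ⟨⟨0, by omega⟩, ⟨0, hα _⟩⟩
      have h2 : φ ⟨1, hm⟩ = 0 := h0 ⟨⟨1, hm⟩, ⟨0, hα _⟩⟩
      have h3 := hφ (show (⟨0, by omega⟩ : Fin m) < ⟨1, hm⟩ by simp)
      rw [h1, h2] at h3
      exact lt_irrefl _ h3
    have hcurve : ∀ (h : Matrix (Idx α) (Idx α) ℝ) (r : ℝ), r ≠ 0 → Preserves True (r • h) →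
        (fun t => toPEE (h * gam α ψ t * hᵀ)) = expCurve (r • h) fun i => φ i.1 := by
      intro h r hr hh
      funext t
      rw [← toPEE_expCurve hl hr hh c t, mul_gam_mul_eq]
      simp [hφdef]
    have hcurve1 : ∀ h : Matrix (Idx α) (Idx α) ℝ, Preserves True h →
        (fun t => toPEE (h * gam α ψ t * hᵀ)) = expCurve h fun i => φ i.1 := fun h hh => by
      have := hcurve h 1 one_ne_zero (by rwa [one_smul])
      rwa [one_smul] at this
    have hγ : (fun t => toPEE (gam α ψ t)) = expCurve 1 fun i => φ i.1 := by
      rw [← hcurve1 1 .one]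
      simp
    rw [hγ, PEE_eq_slice, finitePencil_eq (fun _ => hl) hne, nullPencil_eq (fun _ => hl) hne]
    constructor
    · ext ν
      constructor
      · rintro ⟨h, hh, hT, hν⟩
        exact ⟨h, (mem_blockTri_iff hφ).2 ⟨hh.isUnit, hT⟩, by rwa [hcurve1 h hh]⟩
      · rintro ⟨h, hh, hν⟩
        obtain ⟨hu, hT⟩ := (mem_blockTri_iff hφ).1 hh
        obtain ⟨r, hr, hrh⟩ := exists_smul_preserves hu
        refine ⟨r • h, hrh, fun i j hij => ?_, by rwa [← hcurve h r hr hrh]⟩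
        rw [Matrix.smul_apply, hT i j hij, smul_zero]
    · ext ν
      refine exists_congr fun h => ?_
      rw [mem_blockUni_iff hφ, and_assoc]
      -- Block unipotent matrices have determinant 1 already, so no rescaling is needed.
      refine and_congr_right fun hT => and_congr_right fun h1 => ?_
      rw [hcurve1 h (preserves_of_blockPart_eq_one hT h1)]
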